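/- Let $p_t(x,y)=\frac{1}{\sqrt{2\pi t}}e^{-(y-x)^2/(2t)}$ be the heat kernel on $\mathbb R$. For $t>0$ and $x,y\in(0,1)$ let $$u_t(x,y)=\sum_{k\in\mathbb Z}\big(p_t(x+2k,y)-p_t(-x-2k,y)\big),\qquad q_t(x,y)=\frac{\sin(\pi y)}{\sin(\pi x)}\,e^{\pi^2t/2}\,u_t(x,y),$$ so that $u_t$ is the transition density of the Brownian motion killed at the boundary of $[0,1]$, and for $x\in\{0,1\}$ let $q_t(x,y)=\lim_{x'\to x,\,x'\in(0,1)}q_t(x',y)$. For $\mu\in[0,1]$, the Brownian motion conditioned to stay in $[0,1]$ and started from $\mu$ is the Markov process $(Z_t)_{t\ge 0}$ with $Z_0=\mu$ and transition probabilities $q_t(x,y)\,dy$ on $(0,1)$. For $t>0$, $x\in\mathbb R$ and $\alpha\notin\mathbb Z$ let $$\varphi_\alpha(t,x)=\frac{e^{-\alpha x}}{\sin(\alpha\pi)}\sum_{k\in\mathbb Z}\sinh(\alpha(2kt+x))\,e^{-2(kx+k^2t)},$$ extended by continuity in $\alpha$ to all $\alpha\in\mathbb R$. For $0<r<t$, $0<x<r$,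 $0<y<t$ let $$w^{\mu}((r,x),(t,y))=e^{\mu(y-x)-\frac{t-r}{2}\mu^2}\sum_{k\in\mathbb Z}e^{-2(kx+k^2r)}\big(p_{t-r}(x+2kr,y)-p_{t-r}(-x-2kr,y)\big)$$ (the transition density of the space-time Brownian motion with drift $\mu$ killed at the boundary of the affine cone $C_{\mathrm{aff}}=\{(t,x):0<x<t\}$) and $$s^{\mu}((r,x),(t,y))=\frac{\varphi_\mu(t,y)}{\varphi_\mu(r,x)}\,w^{\mu}((r,x),(t,y)).$$ The space-time Brownian motion with drift $\mu\in[0,1]$ conditioned to stay in $C_{\mathrm{aff}}$ is the Markov process $A^{(\mu)}_t=(t,A^\mu_t)$, $t\ge 0$, in $C_{\mathrm{aff}}\cup\{(0,0)\}$ with $A^{(\mu)}_0=(0,0)$, such that for every $t>0$ the law of $A^\mu_t$ has a density on $(0,t)$ proportional to $$y\mapsto\varphi_\mu(t,y)\,\sin\!\Big(\frac{\pi y}{t}\Big)\,e^{-\frac{1}{2t}(y-\mu t)^2},$$ and such that for $0<r<t$ the conditional law of $A^\mu_t$ given $A^\mu_r=x$ has the density $y\mapsto s^{\mu}((r,x),(t,y))$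 on $(0,t)$. Theorem. For every $\mu\in[0,1]$, the processes $\{A^{(\mu)}_t,\ t>0\}$ and $\{(t,tZ_{1/t}),\ t>0\}$, where $Z$ starts from $\mu$, are equal in law. -/

import Mathlib

open MeasureTheory ProbabilityTheory Filter Topology Set
open scoped NNReal ENNReal

noncomputable section

namespace CondBM

/-- The standard heat kernel `p_t(x, y)` on the real line, `t > 0`. -/
def heatKernel (t x y : ℝ) : ℝ :=
  (√(2 * Real.pi * t))⁻¹ * Real.exp (-(y - x) ^ 2 / (2 * t))

/-! ### The Brownian motion conditioned to stay in `[0, 1]` -/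

/-- The transition density `u_t(x, y)` of the Brownian motion killed at the boundary of `[0, 1]`
(the Dirichlet heat kernel of the interval, in its reflection principle form). -/
def killedIntervalDensity (t x y : ℝ) : ℝ :=
  ∑' k : ℤ, (heatKernel t (x + 2 * k) y - heatKernel t (-x - 2 * k) y)

/-- The Doob transform of `u_t` by the ground state `sin (π x)`, whose eigenvalue is `-π² / 2`,
for starting points `x` in the open interval. -/
def doobIntervalDensity (t x y : ℝ) : ℝ :=
  Real.sin (Real.pi * y) / Real.sin (Real.pi * x) * Real.exp (Real.pi ^ 2 * t / 2) *
    killedIntervalDensity t x y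

open Classical in
/-- The transition density `q_t(x, y)` of the conditioned Brownian motion in `[0, 1]`, for
`y ∈ (0, 1)`: the Doob transform if `x ∈ (0, 1)`, and for an endpoint `x` (an entrance boundary)
its limit at `x` from inside the interval. -/
def intervalDensity (t x y : ℝ) : ℝ :=
  if x ∈ Ioo (0 : ℝ) 1 then doobIntervalDensity t x y
  else limUnder (𝓝[Ioo (0 : ℝ) 1] x) (fun x' => doobIntervalDensity t x' y)

/-- The transition probability `q_t(x, y) dy` on `(0, 1)`. -/
def intervalTransition (t x : ℝ) : Measure ℝ :=
  (volume.restrict (Ioo (0 : ℝ) 1)).withDensity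
    (fun y => ENNReal.ofReal (intervalDensity t x y))

/-- The `σ`-algebra generated by the process `X` up to time `r`. -/
abbrev history {Ω E : Type*} [MeasurableSpace E] (X : ℝ≥0 → Ω → E) (r : ℝ≥0) : MeasurableSpace Ω :=
  ⨆ s ∈ Iic r, MeasurableSpace.comap (X s) inferInstance

/-- `Z` is, under `P`, a Brownian motion conditioned to stay in `[0, 1]`, started from `μ`: the
Markov process (with respect to its own filtration) with transition densities `q_t` and
`Z_0 = μ`. -/
structure IsConditionedIntervalBM {Ω : Type*} [MeasurableSpace Ω] (μ : ℝ) (Z : ℝ≥0 → Ω → ℝ)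
    (P : Measure Ω) : Prop where
  measurable : ∀ t, Measurable (Z t)
  start : ∀ᵐ ω ∂P, Z 0 ω = μ
  markov : ∀ r t : ℝ≥0, r < t → ∀ S : Set ℝ, MeasurableSet S →
    P⟦Z t ⁻¹' S | history Z r⟧ =ᵐ[P]
      fun ω => (intervalTransition ((t : ℝ) - r) (Z r ω)).real S

/-! ### The space-time Brownian motion conditioned to stay in the affine cone -/

/-- The defining series of the theta function `φ_α(t, x)`, for `α ∉ ℤ`. -/
def thetaSeries (α t x : ℝ) : ℝ :=
  Real.exp (-α * x) / Real.sin (α * Real.pi) *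
    ∑' k : ℤ, Real.sinh (α * (2 * k * t + x)) * Real.exp (-2 * (k * x + (k : ℝ) ^ 2 * t))

open Classical in
/-- The theta function `φ_α(t, x)`, for `t > 0`: given by its series if `α ∉ ℤ` and extended by
continuity in `α` to the integers. -/
def theta (α t x : ℝ) : ℝ :=
  if α ∈ range ((↑) : ℤ → ℝ) then limUnder (𝓝[≠] α) (fun β => thetaSeries β t x)
  else thetaSeries α t x

/-- The transition density `w⁰((r, x), (t, y))`, `0 < r < t`, of the driftless space-time Brownian
motion killed at the boundary of the affine cone `{(t, x) | 0 < x < t}`. -/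
def killedConeDensityZero (r x t y : ℝ) : ℝ :=
  ∑' k : ℤ, Real.exp (-2 * (k * x + (k : ℝ) ^ 2 * r)) *
    (heatKernel (t - r) (x + 2 * k * r) y - heatKernel (t - r) (-x - 2 * k * r) y)

/-- The transition density `w^μ((r, x), (t, y))`, `0 < r < t`, of the space-time Brownian motion
with drift `μ` killed at the boundary of the affine cone. -/
def killedConeDensity (μ r x t y : ℝ) : ℝ :=
  Real.exp (μ * (y - x) - (t - r) / 2 * μ ^ 2) * killedConeDensityZero r x t y

/-- The Doob transform `s^μ((r, x), (t, y))` of `w^μ` by `φ_μ`. -/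
def coneDensity (μ r x t y : ℝ) : ℝ :=
  theta μ t y / theta μ r x * killedConeDensity μ r x t y

/-- The probability `s^μ((r, x), (t, y)) dy` on the section `(0, t)` of the affine cone. -/
def coneTransition (μ r x t : ℝ) : Measure ℝ :=
  (volume.restrict (Ioo (0 : ℝ) t)).withDensity (fun y => ENNReal.ofReal (coneDensity μ r x t y))

/-- The entrance density at time `t`, not normalized. -/
def coneEntranceDensity (μ t y : ℝ) : ℝ :=
  theta μ t y * Real.sin (y / t * Real.pi) * Real.exp (-(1 / (2 * t)) * (y - μ * t) ^ 2)

/-- The entrance measure at time `t` on the section `(0, t)` of the affine cone, not normalized. -/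
def coneEntrance (μ t : ℝ) : Measure ℝ :=
  (volume.restrict (Ioo (0 : ℝ) t)).withDensity
    (fun y => ENNReal.ofReal (coneEntranceDensity μ t y))

/-- `A` is, under `P`, a space-time Brownian motion with drift `μ` conditioned to stay in the affine
cone: the space-time Markov process `A_t = (t, A^μ_t)` (with respect to its own filtration) started
from `(0, 0)`, whose entrance law at each time `t > 0` has a density proportional to
`coneEntranceDensity`, and whose transition densities are `s^μ`. -/
structure IsConditionedConeBM {Ω : Type*} [MeasurableSpace Ω] (μ : ℝ) (A : ℝ≥0 → Ω → ℝ × ℝ)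
    (P : Measure Ω) : Prop where
  measurable : ∀ t, Measurable (A t)
  start : ∀ᵐ ω ∂P, A 0 ω = (0, 0)
  time : ∀ t, ∀ᵐ ω ∂P, (A t ω).1 = t
  entrance : ∀ t : ℝ≥0, 0 < t →
    P.map (fun ω => (A t ω).2) = (coneEntrance μ t univ)⁻¹ • coneEntrance μ t
  markov : ∀ r t : ℝ≥0, 0 < r → r < t → ∀ S : Set ℝ, MeasurableSet S →
    P⟦(fun ω => (A t ω).2) ⁻¹' S | history A r⟧ =ᵐ[P]
      fun ω => (coneTransition μ r (A r ω).2 t).real S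

end CondBM

end

/-!
Time inversion maps the killed Brownian motion in the affine cone to the killed Brownian motion in
`[0, 1]`. For a single Gaussian this is the identity
`(y - x)² / (t - r) + x² / r - y² / t = (x / r - y / t)² / (1 / r - 1 / t)`, and the weights
`exp (-2 (k x + k² r))` of the image charges are exactly what makes it hold for each term of the
image series (`killedConeDensityZero_eq`). The same computation identifies the theta function
`φ_μ(t, y)`, up to an explicit Gaussian factor, with the Dirichlet heat kernel
`u_{1/t}(μ, y/t) / sin (π μ)` (`theta_eq`). Hence the entrance density at time `t` is
proportional to the density `invertedDensity` of `t Z_{1/t}`, and the transition density of the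
process in the cone is that of the time reversal of `t ↦ t Z_{1/t}`
(`invertedDensity_mul_coneDensity`). Both processes therefore have the same finite-dimensional
densities, one written forward in time and the other one backward. `exists_duality` and
`map_eq_map_of_duality` carry this out for abstract processes in duality, by induction on the list
of times.

Two analytic points remain. The extension by continuity to `μ = 0` and `μ = 1`, on both sides, is
the derivative of the Dirichlet heat kernel at a zero of `sin (π μ)` (`tendsto_sinRatio`).
Dividing by `φ_μ` requires strict positivity of the Dirichlet heat kernel, and of its normal
derivative at the boundary. Writing `u_s(x, z) = ϑ(z - x) - ϑ(z + x)`, where `ϑ` is the heat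
kernel of the circle `ℝ / 2ℤ`, this follows from the Jacobi triple product, by which `ϑ(z)` is a
positive constant times a product of the increasing functions `1 + 2 q^{2n+1} cos (π z) +
q^{4n+2}` of `cos (π z)`. The triple product is obtained as the limit of its finite form, whose
coefficients are `q`-binomial coefficients (`hasSum_tripleCoeff`, `exists_tendsto_tripleProd`).
-/

noncomputable section

namespace CondBM

/-! ### The Jacobi triple product -/

/-- The `q`-Pochhammer symbol `(p; p)_m = ∏_{j=1}^m (1 - p^j)`. -/
def qPoch (p : ℝ) (m : ℕ) : ℝ := ∏ j ∈ Finset.range m, (1 - p ^ (j + 1))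

/-- The reciprocal `1 / (p; p)_m`, extended by `0` to negative integers `m`. With this convention
the recurrence `qPochInv_sub_one` holds at every integer. -/
def qPochInv (p : ℝ) (m : ℤ) : ℝ := if m < 0 then 0 else (qPoch p m.toNat)⁻¹

lemma qPoch_pos {p : ℝ} (hp0 : 0 < p) (hp1 : p < 1) (m : ℕ) : 0 < qPoch p m :=
  Finset.prod_pos fun j _ => sub_pos.2 (pow_lt_one₀ hp0.le hp1 (by omega))

lemma qPoch_antitone {p : ℝ} (hp0 : 0 < p) (hp1 : p < 1) : Antitone (qPoch p) := by
  refine antitone_nat_of_succ_le fun m => ?_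
  rw [qPoch, Finset.prod_range_succ]
  refine mul_le_of_le_one_right (qPoch_pos hp0 hp1 m).le ?_
  have := pow_pos hp0 (m + 1)
  linarith

lemma qPoch_le_one {p : ℝ} (hp0 : 0 < p) (hp1 : p < 1) (m : ℕ) : qPoch p m ≤ 1 := by
  simpa [qPoch] using qPoch_antitone hp0 hp1 (Nat.zero_le m)

/-- The infinite product `(p; p)_∞` is positive. -/
lemma exists_tendsto_qPoch {p : ℝ} (hp0 : 0 < p) (hp1 : p < 1) :
    ∃ L : ℝ, 0 < L ∧ Tendsto (qPoch p) atTop (𝓝 L) ∧ ∀ m, L ≤ qPoch p m := by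
  have hs : Summable fun j : ℕ => -(p ^ (j + 1)) :=
    ((summable_geometric_of_lt_one hp0.le hp1).comp_injective (add_left_injective 1)).neg
  have hm : Multipliable fun j : ℕ => (1 + -(p ^ (j + 1))) :=
    Real.multipliable_one_add_of_summable hs
  have hne : ∏' j : ℕ, (1 + -(p ^ (j + 1))) ≠ 0 := by
    refine tprod_one_add_ne_zero_of_summable (fun j => ?_) ?_
    · have : p ^ (j + 1) < 1 := pow_lt_one₀ hp0.le hp1 (by omega)
      linarith
    · exact hs.norm
  have ht : Tendsto (qPoch p) atTop (𝓝 (∏' j : ℕ, (1 + -(p ^ (j + 1))))) := by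
    have := hm.hasProd.tendsto_prod_nat
    simp only [← sub_eq_add_neg] at this ⊢
    exact this
  have hge : ∀ m, ∏' j : ℕ, (1 + -(p ^ (j + 1))) ≤ qPoch p m :=
    fun m => (qPoch_antitone hp0 hp1).le_of_tendsto ht m
  refine ⟨_, lt_of_le_of_ne ?_ hne.symm, ht, hge⟩
  exact ge_of_tendsto' ht fun m => (qPoch_pos hp0 hp1 m).le

lemma qPochInv_sub_one {p : ℝ} (hp0 : 0 < p) (hp1 : p < 1) (m : ℤ) :
    qPochInv p (m - 1) = (1 - p ^ m) * qPochInv p m := by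
  rcases lt_trichotomy m 0 with h | rfl | h
  · simp [qPochInv, h, show m < 1 by omega]
  · simp [qPochInv]
  · obtain ⟨n, rfl⟩ : ∃ n : ℕ, m = n + 1 := ⟨(m - 1).toNat, by omega⟩
    have h1 : ¬ ((n : ℤ) + 1 < 0) := by omega
    have h2 : ¬ ((n : ℤ) + 1 - 1 < 0) := by omega
    have h3 : ((n : ℤ) + 1).toNat = n + 1 := by omega
    have h4 : ((n : ℤ) + 1 - 1).toNat = n := by omega
    rw [qPochInv, qPochInv, if_neg h1, if_neg h2, h3, h4, qPoch, qPoch, Finset.prod_range_succ,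
      mul_inv]
    have h5 : (1 - p ^ (n + 1)) ≠ 0 := (sub_pos.2 (pow_lt_one₀ hp0.le hp1 (by omega))).ne'
    have h6 : p ^ ((n : ℤ) + 1) = p ^ (n + 1) := by exact_mod_cast zpow_natCast p (n + 1)
    rw [h6]
    field_simp

lemma qPochInv_nonneg {p : ℝ} (hp0 : 0 < p) (hp1 : p < 1) (m : ℤ) : 0 ≤ qPochInv p m := by
  rw [qPochInv]
  split_ifs
  exacts [le_rfl, (inv_pos.2 (qPoch_pos hp0 hp1 _)).le]

/-- The `k`-th coefficient `q^{k²} [2N choose N + k]_{q²}` of the finite Jacobi triple product. -/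
def tripleCoeff (q : ℝ) (N : ℕ) (k : ℤ) : ℝ :=
  q ^ (k ^ 2) * qPoch (q ^ 2) (2 * N) * (qPochInv (q ^ 2) (N + k) * qPochInv (q ^ 2) (N - k))

/-- The recurrence obtained by multiplying the `N`-th product by
`(1 + q^{2N+1} w) (1 + q^{2N+1} w⁻¹)`, where `w = exp (i φ)`. -/
lemma tripleCoeff_succ {q : ℝ} (hq0 : 0 < q) (hq1 : q < 1) (N : ℕ) (k : ℤ) :
    tripleCoeff q (N + 1) k = (1 + (q ^ (2 * N + 1)) ^ 2) * tripleCoeff q N k +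
      q ^ (2 * N + 1) * (tripleCoeff q N (k - 1) + tripleCoeff q N (k + 1)) := by
  have hp0 : 0 < q ^ 2 := by positivity
  have hp1 : q ^ 2 < 1 := pow_lt_one₀ hq0.le hq1 two_ne_zero
  have e1 := qPochInv_sub_one hp0 hp1 (N + 1 + k)
  have e2 := qPochInv_sub_one hp0 hp1 (N + k)
  have e3 := qPochInv_sub_one hp0 hp1 (N + 1 - k)
  have e4 := qPochInv_sub_one hp0 hp1 (N - k)
  rw [show (N : ℤ) + 1 + k - 1 = N + k by ring] at e1
  rw [show (N : ℤ) + 1 - k - 1 = N - k by ring] at e3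
  have hz : ∀ j : ℤ, (q ^ 2) ^ j = q ^ (2 * j) := fun j => by
    rw [← zpow_natCast, ← zpow_mul]; norm_num
  have hq := hq0.ne'
  have hN : ∀ n : ℕ, q ^ n = q ^ (n : ℤ) := fun n => (zpow_natCast q n).symm
  have hpoch : qPoch (q ^ 2) (2 * (N + 1)) = qPoch (q ^ 2) (2 * N) *
      (1 - q ^ (2 * (2 * (N : ℤ) + 1))) * (1 - q ^ (2 * (2 * (N : ℤ) + 2))) := by
    rw [show 2 * (N + 1) = 2 * N + 1 + 1 by ring, qPoch, Finset.prod_range_succ,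
      Finset.prod_range_succ, ← qPoch, ← pow_mul, ← pow_mul, hN (2 * (2 * N + 1)),
      hN (2 * (2 * N + 1 + 1))]
    push_cast
    rw [show 2 * (2 * (N : ℤ) + 1 + 1) = 2 * (2 * N + 2) by ring]
  simp only [tripleCoeff]
  rw [hpoch, hN (2 * N + 1)]
  push_cast
  rw [show (N : ℤ) + (k - 1) = N + k - 1 by ring, show (N : ℤ) - (k - 1) = N + 1 - k by ring,
    show (N : ℤ) + (k + 1) = N + 1 + k by ring, show (N : ℤ) - (k + 1) = N - k - 1 by ring,
    e2, e4, e1, e3, hz, hz, hz, hz]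
  -- In terms of `a = q^N` and `b = q^k` the recurrence is a polynomial identity.
  have x1 : q ^ ((k - 1) ^ 2) = q ^ (k ^ 2) * (q ^ k)⁻¹ ^ 2 * q := by
    rw [show (k - 1) ^ 2 = k ^ 2 + (-k + -k) + 1 by ring, zpow_add₀ hq, zpow_add₀ hq,
      zpow_add₀ hq, zpow_neg, zpow_one]
    ring
  have x2 : q ^ ((k + 1) ^ 2) = q ^ (k ^ 2) * (q ^ k) ^ 2 * q := by
    rw [show (k + 1) ^ 2 = k ^ 2 + (k + k) + 1 by ring, zpow_add₀ hq, zpow_add₀ hq,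
      zpow_add₀ hq, zpow_one]
    ring
  rw [x1, x2]
  simp only [mul_add, mul_sub, two_mul, zpow_add₀ hq, zpow_sub₀ hq, zpow_one]
  have ha : q ^ (N : ℤ) ≠ 0 := (zpow_pos hq0 _).ne'
  have hb : q ^ k ≠ 0 := (zpow_pos hq0 _).ne'
  generalize q ^ (N : ℤ) = a at *
  generalize q ^ k = b at *
  generalize q ^ (k ^ 2) = c
  generalize qPochInv (q ^ 2) _ = E
  generalize qPochInv (q ^ 2) _ = E'
  field_simp
  ring

/-- The finite Jacobi triple product, on the unit circle. -/
lemma hasSum_tripleCoeff {q : ℝ} (hq0 : 0 < q) (hq1 : q < 1) (N : ℕ) (φ : ℝ) :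
    HasSum (fun k : ℤ => tripleCoeff q N k * Real.cos (k * φ))
      (∏ n ∈ Finset.range N, (1 + 2 * q ^ (2 * n + 1) * Real.cos φ + (q ^ (2 * n + 1)) ^ 2)) := by
  induction N with
  | zero =>
    have h : ∀ k : ℤ, k ≠ 0 → tripleCoeff q 0 k * Real.cos (k * φ) = 0 := by
      intro k hk
      rcases lt_or_gt_of_ne hk with h | h
      · simp [tripleCoeff, qPochInv, h]
      · simp [tripleCoeff, qPochInv, h]
    have := hasSum_single (f := fun k : ℤ => tripleCoeff q 0 k * Real.cos (k * φ)) 0 h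
    simpa [tripleCoeff, qPochInv, qPoch] using this
  | succ N ih =>
    -- Only the coefficients with `|k| ≤ N` are nonzero.
    have hfin : ∀ g : ℤ → ℝ, Summable fun k : ℤ => tripleCoeff q N k * g k := by
      intro g
      refine summable_of_ne_finset_zero (s := Finset.Icc (-(N : ℤ)) N) fun k hk => ?_
      rw [Finset.mem_Icc, not_and_or, not_le, not_le] at hk
      rcases hk with hk | hk
      · simp [tripleCoeff, qPochInv, show (N : ℤ) + k < 0 by omega]
      · simp [tripleCoeff, qPochInv, show (N : ℤ) < k by omega]
    have hp := (hfin fun k => Real.cos ((k + 1) * φ)).hasSum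
    have hm := (hfin fun k => Real.cos ((k - 1) * φ)).hasSum
    have hpm := (hp.add hm).unique (a₂ := 2 * Real.cos φ * _) <| by
      refine (ih.mul_left (2 * Real.cos φ)).congr_fun fun k => ?_
      rw [add_mul, sub_mul, one_mul, Real.cos_add, Real.cos_sub]
      ring
    have hp' := (Equiv.subRight (1 : ℤ)).hasSum_iff.2 hp
    have hm' := (Equiv.addRight (1 : ℤ)).hasSum_iff.2 hm
    have := (ih.mul_left (1 + (q ^ (2 * N + 1)) ^ 2)).add
      ((hp'.add hm').mul_left (q ^ (2 * N + 1)))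
    rw [hpm] at this
    rw [Finset.prod_range_succ]
    rw [show ∀ x y z : ℝ, (1 + y ^ 2) * x + y * (2 * z * x) = x * (1 + 2 * y * z + y ^ 2) by
      intros; ring] at this
    refine this.congr_fun fun k => ?_
    · simp only [tripleCoeff_succ hq0 hq1, Function.comp_apply, Equiv.subRight_apply,
        Equiv.coe_addRight]
      push_cast
      simp only [sub_add_cancel, add_sub_cancel_right]
      ring

lemma summable_zpow_sq {q : ℝ} (hq0 : 0 < q) (hq1 : q < 1) :
    Summable fun k : ℤ => q ^ (k ^ 2) := by
  have h : Summable fun n : ℕ => q ^ n := summable_geometric_of_lt_one hq0.le hq1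
  have h2 : Summable fun n : ℕ => q ^ (((n : ℤ)) ^ 2) := by
    refine h.of_nonneg_of_le (fun n => (zpow_pos hq0 _).le) fun n => ?_
    rw [← zpow_natCast]
    exact zpow_le_zpow_right_of_le_one₀ hq0 hq1.le
      (by exact_mod_cast Nat.le_self_pow two_ne_zero n)
  refine Summable.of_nat_of_neg h2 ?_
  simpa using h2

/-- The Jacobi triple product: up to a positive constant, the theta series is the infinite product
of the factors `1 + 2 q^{2n+1} cos φ + q^{4n+2}`. -/
lemma exists_tendsto_tripleProd {q : ℝ} (hq0 : 0 < q) (hq1 : q < 1) :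
    ∃ L : ℝ, 0 < L ∧ ∀ φ : ℝ, Tendsto (fun N : ℕ => ∏ n ∈ Finset.range N,
        (1 + 2 * q ^ (2 * n + 1) * Real.cos φ + (q ^ (2 * n + 1)) ^ 2)) atTop
      (𝓝 (L * ∑' k : ℤ, q ^ (k ^ 2) * Real.cos (k * φ))) := by
  have hp0 : 0 < q ^ 2 := by positivity
  have hp1 : q ^ 2 < 1 := pow_lt_one₀ hq0.le hq1 two_ne_zero
  obtain ⟨L, hL, hlim, hle⟩ := exists_tendsto_qPoch hp0 hp1
  refine ⟨L⁻¹, inv_pos.2 hL, fun φ => ?_⟩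
  have hinv : ∀ m : ℤ, qPochInv (q ^ 2) m ≤ L⁻¹ := by
    intro m
    rw [qPochInv]
    split_ifs
    · exact (inv_pos.2 hL).le
    · exact inv_anti₀ hL (hle _)
  have hlinv : ∀ k : ℤ, Tendsto (fun N : ℕ => qPochInv (q ^ 2) (N + k)) atTop (𝓝 L⁻¹) := by
    intro k
    have h1 : Tendsto (fun N : ℕ => ((N : ℤ) + k).toNat) atTop atTop := by
      refine tendsto_atTop.2 fun b => ?_
      filter_upwards [eventually_ge_atTop (b + k.natAbs)] with N hN
      omega
    refine ((hlim.comp h1).inv₀ hL.ne').congr' ?_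
    filter_upwards [eventually_ge_atTop k.natAbs] with N hN
    rw [qPochInv, if_neg (by omega), Function.comp_apply]
  have hcoeff : ∀ k : ℤ, Tendsto (fun N => tripleCoeff q N k) atTop (𝓝 (L⁻¹ * q ^ (k ^ 2))) := by
    intro k
    have h2 : Tendsto (fun N : ℕ => 2 * N) atTop atTop :=
      tendsto_id.const_mul_atTop' two_pos
    have := ((hlim.comp h2).const_mul (q ^ (k ^ 2))).mul ((hlinv k).mul (hlinv (-k)))
    rw [show q ^ (k ^ 2) * L * (L⁻¹ * L⁻¹) = L⁻¹ * q ^ (k ^ 2) by field_simp] at this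
    exact this
  have key := tendsto_tsum_of_dominated_convergence
    (f := fun N (k : ℤ) => tripleCoeff q N k * Real.cos (k * φ)) (𝓕 := atTop)
    (g := fun k : ℤ => L⁻¹ * q ^ (k ^ 2) * Real.cos (k * φ))
    (bound := fun k : ℤ => q ^ (k ^ 2) * (L⁻¹ * L⁻¹))
    ((summable_zpow_sq hq0 hq1).mul_right _) (fun k => (hcoeff k).mul_const _) ?_
  · simp_rw [mul_assoc, tsum_mul_left] at key
    refine key.congr fun N => ?_
    simpa only [mul_assoc] using (hasSum_tripleCoeff hq0 hq1 N φ).tsum_eq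
  · refine Eventually.of_forall fun N k => ?_
    rw [norm_mul]
    have hz := zpow_pos hq0 (k ^ 2)
    have h1 := qPochInv_nonneg hp0 hp1 (N + k)
    have h2 := qPochInv_nonneg hp0 hp1 (N - k)
    have h3 := (qPoch_pos hp0 hp1 (2 * N)).le
    have h0 : 0 ≤ tripleCoeff q N k := by rw [tripleCoeff]; positivity
    have h4 : tripleCoeff q N k ≤ q ^ (k ^ 2) * 1 * (L⁻¹ * L⁻¹) := by
      rw [tripleCoeff]
      gcongr
      exacts [qPoch_le_one hp0 hp1 _, hinv _, hinv _]
    calc ‖tripleCoeff q N k‖ * ‖Real.cos (k * φ)‖ ≤ tripleCoeff q N k * 1 := by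
          rw [Real.norm_of_nonneg h0]
          exact mul_le_mul_of_nonneg_left (Real.abs_cos_le_one _) h0
      _ ≤ _ := by linarith

/-- The theta series is increasing in `cos φ`, at least as fast as the first factor of its product
expansion. -/
lemma thetaSum_mul_le {q : ℝ} (hq0 : 0 < q) (hq1 : q < 1) {a b : ℝ}
    (hab : Real.cos b ≤ Real.cos a) :
    (∑' k : ℤ, q ^ (k ^ 2) * Real.cos (k * b)) * (1 + 2 * q * Real.cos a + q ^ 2) ≤
      (∑' k : ℤ, q ^ (k ^ 2) * Real.cos (k * a)) * (1 + 2 * q * Real.cos b + q ^ 2) := by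
  obtain ⟨L, hL, hlim⟩ := exists_tendsto_tripleProd hq0 hq1
  have hpos : ∀ (r φ : ℝ), 0 ≤ 1 + 2 * r * Real.cos φ + r ^ 2 := by
    intro r φ
    nlinarith [sq_nonneg (r + Real.cos φ), Real.sin_sq_add_cos_sq φ, sq_nonneg (Real.sin φ)]
  -- All factors but the first are compared termwise; the first one is kept on the other side.
  have hle := le_of_tendsto_of_tendsto' (((hlim b).comp (tendsto_add_atTop_nat 1)).mul_const
      (1 + 2 * q * Real.cos a + q ^ 2))
    (((hlim a).comp (tendsto_add_atTop_nat 1)).mul_const (1 + 2 * q * Real.cos b + q ^ 2)) <| by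
    intro N
    simp only [Function.comp_apply, Finset.prod_range_succ', mul_zero, zero_add, pow_one]
    rw [mul_assoc, mul_assoc (Finset.prod _ _), mul_comm (1 + 2 * q * Real.cos b + q ^ 2)]
    refine mul_le_mul_of_nonneg_right (Finset.prod_le_prod (fun n _ => hpos _ _) fun n _ => ?_)
      (mul_nonneg (hpos _ _) (hpos _ _))
    have := mul_le_mul_of_nonneg_left hab (pow_pos hq0 (2 * (n + 1) + 1)).le
    linarith
  rw [mul_assoc L, mul_assoc L] at hle
  exact le_of_mul_le_mul_left hle hL

/-! ### The Dirichlet heat kernel of the interval -/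

/-- The heat kernel of the circle `ℝ / 2ℤ`, normalized as in `hasSum_circleHeat`, written through
the cosine kernel of Mathlib. -/
def circleHeat (s z : ℝ) : ℝ :=
  HurwitzZeta.cosKernel ((z / 2 : ℝ) : UnitAddCircle) (Real.pi * s / 2) / 2

/-- `circleHeat` is the `2ℤ`-periodization of the heat kernel of the line. -/
lemma hasSum_circleHeat {s : ℝ} (hs : 0 < s) (z : ℝ) :
    HasSum (fun k : ℤ => heatKernel s 0 (z + 2 * k)) (circleHeat s z) := by
  have hpi := Real.pi_pos
  have h := (HurwitzZeta.hasSum_int_evenKernel (z / 2) (t := 2 / (Real.pi * s))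
    (by positivity)).mul_left (√(2 * Real.pi * s))⁻¹
  rw [HurwitzZeta.evenKernel_functional_equation, one_div_div, ← Real.sqrt_eq_rpow,
    Real.sqrt_div two_pos.le] at h
  have hv : (√(2 * Real.pi * s))⁻¹ * (1 / (√2 / √(Real.pi * s)) *
      HurwitzZeta.cosKernel ((z / 2 : ℝ) : UnitAddCircle) (Real.pi * s / 2)) = circleHeat s z := by
    rw [circleHeat, mul_assoc 2, Real.sqrt_mul two_pos.le]
    have h1 : √(Real.pi * s) ≠ 0 := by positivity
    have h2 : √2 * √2 = (2 : ℝ) := Real.mul_self_sqrt two_pos.le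
    field_simp
    rw [sq, h2]
  rw [hv] at h
  refine h.congr_fun fun k => ?_
  rw [heatKernel]
  congr 2
  field_simp
  ring

/-- The Fourier series of `circleHeat`: a theta series with nome `q = exp (-π² s / 2)`. -/
lemma hasSum_circleHeat_cos {s : ℝ} (hs : 0 < s) (z : ℝ) :
    HasSum (fun k : ℤ => Real.exp (-(Real.pi ^ 2 * s / 2)) ^ (k ^ 2) *
      Real.cos (k * (Real.pi * z))) (2 * circleHeat s z) := by
  have hpi := Real.pi_pos
  have h := Complex.hasSum_re (HurwitzZeta.hasSum_int_cosKernel (z / 2) (t := Real.pi * s / 2)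
    (by positivity))
  rw [Complex.ofReal_re, show HurwitzZeta.cosKernel ((z / 2 : ℝ) : UnitAddCircle)
    (Real.pi * s / 2) = 2 * circleHeat s z by rw [circleHeat]; ring] at h
  refine h.congr_fun fun k => ?_
  rw [Complex.re_mul_ofReal, mul_comm,
    show (2 * Real.pi * Complex.I * ((z / 2 : ℝ) : ℂ) * k : ℂ) =
      ((k * (Real.pi * z) : ℝ) : ℂ) * Complex.I by push_cast; ring, Complex.exp_ofReal_mul_I_re,
    ← Real.rpow_intCast, ← Real.exp_mul]
  congr 2
  push_cast
  ring

lemma differentiable_circleHeat {s : ℝ} (hs : 0 < s) : Differentiable ℝ (circleHeat s) := by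
  have hpi := Real.pi_pos
  have h : circleHeat s = fun z => (jacobiTheta₂ ((z / 2 : ℝ) : ℂ)
      (Complex.I * ((Real.pi * s / 2 : ℝ) : ℂ))).re / 2 := by
    ext z
    rw [← HurwitzZeta.cosKernel_def, Complex.ofReal_re, circleHeat]
  intro z
  have h1 := (hasDerivAt_jacobiTheta₂_fst ((z / 2 : ℝ) : ℂ)
    (τ := Complex.I * ((Real.pi * s / 2 : ℝ) : ℂ)) (by simp; positivity)).real_of_complex
  rw [h]
  exact (DifferentiableAt.fun_comp' z h1.differentiableAt
    (differentiableAt_id.div_const (2 : ℝ))).div_const 2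

lemma circleHeat_neg (s z : ℝ) : circleHeat s (-z) = circleHeat s z := by
  rw [circleHeat, circleHeat, neg_div, AddCircle.coe_neg, HurwitzZeta.cosKernel_neg]

lemma circleHeat_add_two (s z : ℝ) : circleHeat s (z + 2) = circleHeat s z := by
  rw [circleHeat, circleHeat, add_div, div_self two_ne_zero, AddCircle.coe_add,
    AddCircle.coe_period, add_zero]

lemma heatKernel_pos {s : ℝ} (hs : 0 < s) (x y : ℝ) : 0 < heatKernel s x y := by
  have := Real.pi_pos
  rw [heatKernel]
  positivity

lemma circleHeat_pos {s : ℝ} (hs : 0 < s) (z : ℝ) : 0 < circleHeat s z := by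
  have h := hasSum_circleHeat hs z
  rw [← h.tsum_eq]
  exact h.summable.tsum_pos (fun k => (heatKernel_pos hs _ _).le) 0 (heatKernel_pos hs _ _)

lemma heatKernel_eq_sub (s x y : ℝ) : heatKernel s x y = heatKernel s 0 (y - x) := by
  rw [heatKernel, heatKernel, sub_zero]

lemma hasSum_killedIntervalDensity {s : ℝ} (hs : 0 < s) (x z : ℝ) :
    HasSum (fun k : ℤ => heatKernel s (x + 2 * k) z - heatKernel s (-x - 2 * k) z)
      (circleHeat s (z - x) - circleHeat s (z + x)) := by
  refine HasSum.sub ?_ ?_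
  -- The reflection `k ↦ -k` turns the direct images into a periodization around `z - x`.
  · refine ((Equiv.neg ℤ).hasSum_iff.2 (hasSum_circleHeat hs (z - x))).congr_fun fun k => ?_
    rw [heatKernel_eq_sub, Function.comp_apply, Equiv.neg_apply]
    push_cast
    ring_nf
  · refine (hasSum_circleHeat hs (z + x)).congr_fun fun k => ?_
    rw [heatKernel_eq_sub]
    ring_nf

/-- The method of images: the Dirichlet heat kernel of `[0, 1]` is a difference of two values of
the heat kernel of the circle `ℝ / 2ℤ`. -/
lemma killedIntervalDensity_eq {s : ℝ} (hs : 0 < s) (x z : ℝ) :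
    killedIntervalDensity s x z = circleHeat s (z - x) - circleHeat s (z + x) :=
  (hasSum_killedIntervalDensity hs x z).tsum_eq

lemma killedIntervalDensity_comm {s : ℝ} (hs : 0 < s) (x z : ℝ) :
    killedIntervalDensity s x z = killedIntervalDensity s z x := by
  rw [killedIntervalDensity_eq hs, killedIntervalDensity_eq hs, ← neg_sub x z, circleHeat_neg,
    add_comm]

lemma continuous_killedIntervalDensity {s : ℝ} (hs : 0 < s) :
    Continuous fun p : ℝ × ℝ => killedIntervalDensity s p.1 p.2 := by
  simp_rw [killedIntervalDensity_eq hs]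
  have := (differentiable_circleHeat hs).continuous
  fun_prop

lemma differentiable_killedIntervalDensity_left {s : ℝ} (hs : 0 < s) (z : ℝ) :
    Differentiable ℝ fun x => killedIntervalDensity s x z := by
  simp_rw [killedIntervalDensity_eq hs]
  have := differentiable_circleHeat hs
  fun_prop

lemma killedIntervalDensity_of_sin_eq_zero {s : ℝ} (hs : 0 < s) {x : ℝ}
    (hx : Real.sin (Real.pi * x) = 0) (z : ℝ) : killedIntervalDensity s x z = 0 := by
  obtain ⟨n, hn⟩ := Real.sin_eq_zero_iff.1 hx
  have hx' : x = n := by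
    rw [mul_comm] at hn
    exact (mul_left_cancel₀ Real.pi_ne_zero hn).symm
  have hper : Function.Periodic (circleHeat s) 2 := circleHeat_add_two s
  rw [killedIntervalDensity_eq hs, hx', ← hper.int_mul n (z - n)]
  ring_nf

/-- A quantitative form of the positivity of the Dirichlet heat kernel, sharp enough to survive the
division by `sin (π x)` at the boundary. -/
lemma le_killedIntervalDensity {s x z : ℝ} (hs : 0 < s) (hx : 0 ≤ Real.sin (Real.pi * x))
    (hz : 0 ≤ Real.sin (Real.pi * z)) :
    Real.exp (-(Real.pi ^ 2 * s / 2)) * Real.sin (Real.pi * z) * circleHeat s (z + x) *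
      Real.sin (Real.pi * x) ≤ killedIntervalDensity s x z := by
  have hpi := Real.pi_pos
  set q := Real.exp (-(Real.pi ^ 2 * s / 2)) with hq
  have hq0 : 0 < q := Real.exp_pos _
  have hq1 : q < 1 := Real.exp_lt_one_iff.2 (neg_lt_zero.2 (by positivity))
  have hcos : Real.cos (Real.pi * (z - x)) - Real.cos (Real.pi * (z + x)) =
      2 * Real.sin (Real.pi * x) * Real.sin (Real.pi * z) := by
    rw [mul_sub, mul_add, Real.cos_sub, Real.cos_add]
    ring
  have hprod := mul_nonneg hx hz
  have h := thetaSum_mul_le hq0 hq1 (a := Real.pi * (z - x)) (b := Real.pi * (z + x))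
    (by linarith)
  rw [(hasSum_circleHeat_cos hs _).tsum_eq, (hasSum_circleHeat_cos hs _).tsum_eq] at h
  rw [killedIntervalDensity_eq hs]
  have hb := circleHeat_pos hs (z + x)
  generalize circleHeat s (z + x) = B at *
  generalize circleHeat s (z - x) = A at *
  have hc1 := Real.cos_le_one (Real.pi * (z + x))
  have hc2 := Real.neg_one_le_cos (Real.pi * (z + x))
  generalize Real.cos (Real.pi * (z + x)) = c at *
  have hcos' : Real.cos (Real.pi * (z - x)) = c + 2 * (Real.sin (Real.pi * x) *
    Real.sin (Real.pi * z)) := by linarith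
  rw [hcos'] at h
  have hf : 0 < 1 + 2 * q * c + q ^ 2 := by nlinarith
  have hf4 : 1 + 2 * q * c + q ^ 2 ≤ 4 := by nlinarith
  have hmul : 4 * (q * (Real.sin (Real.pi * x) * Real.sin (Real.pi * z)) * B) ≤
      (A - B) * (1 + 2 * q * c + q ^ 2) := by linarith
  have hAB : 0 ≤ A - B := by
    refine nonneg_of_mul_nonneg_left (le_trans ?_ hmul) hf
    positivity
  have := mul_le_mul_of_nonneg_left hf4 hAB
  linarith

/-- The ratio `u_s(x, z) / sin (π x)`, extended by continuity to the zeros of `sin (π x)`. -/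
def sinRatio (s x z : ℝ) : ℝ :=
  if Real.sin (Real.pi * x) = 0 then
    deriv (fun x' => killedIntervalDensity s x' z) x / (Real.pi * Real.cos (Real.pi * x))
  else killedIntervalDensity s x z / Real.sin (Real.pi * x)

lemma tendsto_sinRatio {s : ℝ} (hs : 0 < s) (x z : ℝ) :
    Tendsto (fun x' => killedIntervalDensity s x' z / Real.sin (Real.pi * x')) (𝓝[≠] x)
      (𝓝 (sinRatio s x z)) := by
  have hsin : HasDerivAt (fun x' => Real.sin (Real.pi * x'))
      (Real.pi * Real.cos (Real.pi * x)) x := by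
    simpa [mul_comm] using ((hasDerivAt_id x).const_mul Real.pi).sin
  have hu := (differentiable_killedIntervalDensity_left hs z x).hasDerivAt
  rw [sinRatio]
  split_ifs with h
  · have hc : Real.pi * Real.cos (Real.pi * x) ≠ 0 := by
      refine mul_ne_zero Real.pi_ne_zero fun h0 => ?_
      have := Real.sin_sq_add_cos_sq (Real.pi * x)
      rw [h, h0] at this
      norm_num at this
    refine (hu.tendsto_slope.div hsin.tendsto_slope hc).congr' ?_
    filter_upwards [self_mem_nhdsWithin] with y hy
    have hy' : y - x ≠ 0 := sub_ne_zero.2 hy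
    rw [Pi.div_apply, slope_def_field, slope_def_field, h,
      killedIntervalDensity_of_sin_eq_zero hs h, sub_zero, sub_zero]
    field_simp
  · exact (hu.continuousAt.div hsin.continuousAt h).tendsto.mono_left nhdsWithin_le_nhds

lemma measurable_sinRatio {s : ℝ} (hs : 0 < s) (x : ℝ) : Measurable (sinRatio s x) := by
  have hd : ∀ z, HasDerivAt (fun x' => killedIntervalDensity s x' z)
      (-deriv (circleHeat s) (z - x) - deriv (circleHeat s) (z + x)) x := by
    intro z
    simp_rw [killedIntervalDensity_eq hs]
    have h1 := ((differentiable_circleHeat hs) (z - x)).hasDerivAt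
    have h2 := ((differentiable_circleHeat hs) (z + x)).hasDerivAt
    exact (h1.comp_const_sub z x).fun_sub (h2.comp_const_add z x)
  by_cases h : Real.sin (Real.pi * x) = 0
  · have : sinRatio s x = fun z => (-deriv (circleHeat s) (z - x) - deriv (circleHeat s) (z + x)) /
        (Real.pi * Real.cos (Real.pi * x)) := by
      ext z
      rw [sinRatio, if_pos h, (hd z).deriv]
    rw [this]
    have := measurable_deriv (circleHeat s)
    fun_prop
  · have : sinRatio s x = fun z => killedIntervalDensity s x z / Real.sin (Real.pi * x) := by
      ext z
      rw [sinRatio, if_neg h]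
    rw [this]
    have := (continuous_killedIntervalDensity hs).measurable.comp (measurable_prodMk_left (x := x))
    exact this.div_const _

lemma sin_pi_mul_pos {x : ℝ} (hx : x ∈ Ioo (0 : ℝ) 1) : 0 < Real.sin (Real.pi * x) :=
  Real.sin_pos_of_pos_of_lt_pi (mul_pos Real.pi_pos hx.1)
    (by nlinarith [Real.pi_pos, hx.2])

lemma nhdsWithin_Ioo_neBot {x : ℝ} (hx : x ∈ Icc (0 : ℝ) 1) : (𝓝[Ioo (0 : ℝ) 1] x).NeBot := by
  rw [← mem_closure_iff_nhdsWithin_neBot, closure_Ioo zero_ne_one]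
  exact hx

/-- Positivity includes the endpoints `x = 0` and `x = 1`, where the lower bound
`le_killedIntervalDensity`, divided by `sin (π x)`, passes to the limit. -/
lemma sinRatio_pos {s x z : ℝ} (hs : 0 < s) (hx : x ∈ Icc (0 : ℝ) 1) (hz : z ∈ Ioo (0 : ℝ) 1) :
    0 < sinRatio s x z := by
  have hsz := sin_pi_mul_pos hz
  have hB := circleHeat_pos hs (z + x)
  have hlow : 0 < Real.exp (-(Real.pi ^ 2 * s / 2)) * Real.sin (Real.pi * z) *
      circleHeat s (z + x) := by positivity
  refine hlow.trans_le ?_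
  by_cases h : x ∈ Ioo (0 : ℝ) 1
  · have hsx := sin_pi_mul_pos h
    rw [sinRatio, if_neg hsx.ne', le_div_iff₀ hsx]
    exact le_killedIntervalDensity hs hsx.le hsz.le
  · have := nhdsWithin_Ioo_neBot hx
    have hsub : 𝓝[Ioo (0 : ℝ) 1] x ≤ 𝓝[≠] x :=
      nhdsWithin_mono x fun y hy hyx => h (hyx ▸ hy)
    have hcont : Continuous fun x' => Real.exp (-(Real.pi ^ 2 * s / 2)) * Real.sin (Real.pi * z) *
        circleHeat s (z + x') := by
      have := (differentiable_circleHeat hs).continuous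
      fun_prop
    refine le_of_tendsto_of_tendsto (hcont.continuousAt.tendsto.mono_left nhdsWithin_le_nhds)
      ((tendsto_sinRatio hs x z).mono_left hsub) ?_
    filter_upwards [self_mem_nhdsWithin] with y hy
    have hsy := sin_pi_mul_pos hy
    rw [le_div_iff₀ hsy]
    exact le_killedIntervalDensity hs hsy.le hsz.le

/-! ### Time inversion of the transition densities -/

/-- The Gaussian factor relating `theta` at time `t` to the killed Brownian motion at time `1 / t`,
see `thetaSeries_mul_gaussFactor`. -/
def gaussFactor (μ t y : ℝ) : ℝ :=
  2 * (√(2 * Real.pi * t⁻¹))⁻¹ * Real.exp (-(y - μ * t) ^ 2 / (2 * t))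

lemma gaussFactor_pos {t : ℝ} (ht : 0 < t) (μ y : ℝ) : 0 < gaussFactor μ t y := by
  have := Real.pi_pos
  rw [gaussFactor]
  positivity

lemma continuous_gaussFactor (t y : ℝ) : Continuous fun μ => gaussFactor μ t y := by
  unfold gaussFactor
  fun_prop

/-- Time inversion turns the theta function into the Dirichlet heat kernel seen from `α`. At
integers `α` both sides are `0`, as quotients by zero. -/
lemma thetaSeries_mul_gaussFactor {t : ℝ} (ht : 0 < t) (α y : ℝ) :
    thetaSeries α t y * gaussFactor α t y =
      killedIntervalDensity t⁻¹ α (y / t) / Real.sin (Real.pi * α) := by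
  have hs : 0 < t⁻¹ := inv_pos.2 ht
  have h := (hasSum_circleHeat hs (y / t - α)).sub (hasSum_circleHeat hs (y / t + α))
  have hterm : ∀ k : ℤ, heatKernel t⁻¹ 0 (y / t - α + 2 * k) - heatKernel t⁻¹ 0 (y / t + α + 2 * k)
      = gaussFactor α t y * Real.exp (-α * y) *
        (Real.sinh (α * (2 * k * t + y)) * Real.exp (-2 * (k * y + (k : ℝ) ^ 2 * t))) := by
    intro k
    rw [heatKernel, heatKernel, gaussFactor, Real.sinh_eq,
      show -(y / t - α + 2 * k - 0) ^ 2 / (2 * t⁻¹) = -(y - α * t) ^ 2 / (2 * t) + -α * y +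
        α * (2 * k * t + y) + -2 * (k * y + (k : ℝ) ^ 2 * t) by field_simp; ring,
      show -(y / t + α + 2 * k - 0) ^ 2 / (2 * t⁻¹) = -(y - α * t) ^ 2 / (2 * t) + -α * y +
        -(α * (2 * k * t + y)) + -2 * (k * y + (k : ℝ) ^ 2 * t) by field_simp; ring]
    simp only [Real.exp_add]
    ring
  simp_rw [hterm] at h
  have hu := h.tsum_eq
  rw [tsum_mul_left, ← killedIntervalDensity_eq hs] at hu
  rw [← hu, thetaSeries, mul_comm α Real.pi]
  ring

lemma sin_pi_mul_eq_zero_iff (x : ℝ) :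
    Real.sin (Real.pi * x) = 0 ↔ x ∈ range ((↑) : ℤ → ℝ) := by
  rw [Real.sin_eq_zero_iff]
  refine exists_congr fun n => ?_
  rw [mul_comm, mul_right_inj' Real.pi_ne_zero]

/-- The limit defining `theta` at integers exists, and `theta` is given there by the extension of
`sinRatio` as well. -/
lemma theta_eq {t : ℝ} (ht : 0 < t) (α y : ℝ) :
    theta α t y = sinRatio t⁻¹ α (y / t) / gaussFactor α t y := by
  have hs : 0 < t⁻¹ := inv_pos.2 ht
  have hg : ∀ β, thetaSeries β t y =
      killedIntervalDensity t⁻¹ β (y / t) / Real.sin (Real.pi * β) / gaussFactor β t y :=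
    fun β => by
      rw [← thetaSeries_mul_gaussFactor ht, mul_div_cancel_right₀ _ (gaussFactor_pos ht _ _).ne']
  rw [theta]
  split_ifs with h
  · refine Tendsto.limUnder_eq ?_
    simp_rw [hg]
    exact (tendsto_sinRatio hs α (y / t)).div
      ((continuous_gaussFactor t y).continuousAt.tendsto.mono_left nhdsWithin_le_nhds)
      (gaussFactor_pos ht _ _).ne'
  · rw [hg, sinRatio, if_neg (mt (sin_pi_mul_eq_zero_iff α).1 h)]

lemma doobIntervalDensity_eq (s x z : ℝ) : doobIntervalDensity s x z =
    Real.sin (Real.pi * z) * Real.exp (Real.pi ^ 2 * s / 2) *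
      (killedIntervalDensity s x z / Real.sin (Real.pi * x)) := by
  rw [doobIntervalDensity]
  ring

/-- This covers the endpoints `x = 0` and `x = 1`, where `intervalDensity` is a limit. -/
lemma intervalDensity_eq {s x : ℝ} (hs : 0 < s) (hx : x ∈ Icc (0 : ℝ) 1) (z : ℝ) :
    intervalDensity s x z =
      Real.sin (Real.pi * z) * Real.exp (Real.pi ^ 2 * s / 2) * sinRatio s x z := by
  rw [intervalDensity]
  split_ifs with h
  · rw [doobIntervalDensity_eq, sinRatio, if_neg (sin_pi_mul_pos h).ne']
  · have := nhdsWithin_Ioo_neBot hx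
    have hsub : 𝓝[Ioo (0 : ℝ) 1] x ≤ 𝓝[≠] x :=
      nhdsWithin_mono x fun y hy hyx => h (hyx ▸ hy)
    refine Tendsto.limUnder_eq ?_
    simp_rw [doobIntervalDensity_eq]
    exact ((tendsto_sinRatio hs x z).mono_left hsub).const_mul _

lemma intervalDensity_of_mem {s x : ℝ} (hx : x ∈ Ioo (0 : ℝ) 1) (z : ℝ) :
    intervalDensity s x z = doobIntervalDensity s x z := if_pos hx

lemma intervalDensity_pos {s x z : ℝ} (hs : 0 < s) (hx : x ∈ Icc (0 : ℝ) 1)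
    (hz : z ∈ Ioo (0 : ℝ) 1) : 0 < intervalDensity s x z := by
  have := sinRatio_pos hs hx hz
  have := sin_pi_mul_pos hz
  rw [intervalDensity_eq hs hx]
  positivity

lemma measurable_intervalDensity {s x : ℝ} (hs : 0 < s) (hx : x ∈ Icc (0 : ℝ) 1) :
    Measurable (intervalDensity s x) := by
  have : intervalDensity s x = fun z =>
      Real.sin (Real.pi * z) * Real.exp (Real.pi ^ 2 * s / 2) * sinRatio s x z :=
    funext fun z => intervalDensity_eq hs hx z
  rw [this]
  have := measurable_sinRatio hs x
  fun_prop

lemma measurable_doobIntervalDensity {s : ℝ} (hs : 0 < s) :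
    Measurable fun p : ℝ × ℝ => doobIntervalDensity s p.1 p.2 := by
  have := (continuous_killedIntervalDensity hs).measurable
  unfold doobIntervalDensity
  fun_prop

/-- Time inversion turns the killed Brownian motion in the affine cone into the killed Brownian
motion in the interval. -/
lemma killedConeDensityZero_eq {r t : ℝ} (hr : 0 < r) (hrt : r < t) (x y : ℝ) :
    killedConeDensityZero r x t y = (√(2 * Real.pi * (t - r)))⁻¹ *
      √(2 * Real.pi * (r⁻¹ - t⁻¹)) * Real.exp (x ^ 2 / (2 * r) - y ^ 2 / (2 * t)) *
        killedIntervalDensity (r⁻¹ - t⁻¹) (x / r) (y / t) := by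
  have ht : 0 < t := hr.trans hrt
  have htr : t - r ≠ 0 := (sub_pos.2 hrt).ne'
  have hs : 0 < r⁻¹ - t⁻¹ := sub_pos.2 (inv_strictAnti₀ hr hrt)
  have hpi := Real.pi_pos
  have hsq : √(2 * Real.pi * (r⁻¹ - t⁻¹)) ≠ 0 := by positivity
  have hst : r⁻¹ - t⁻¹ = (t - r) / (r * t) := by field_simp
  rw [killedConeDensityZero, killedIntervalDensity, ← tsum_mul_left]
  refine tsum_congr fun k => ?_
  have hexp : ∀ v : ℝ, -(y / t - v / r) ^ 2 / (2 * (r⁻¹ - t⁻¹)) =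
      -(y - v) ^ 2 / (2 * (t - r)) - v ^ 2 / (2 * r) + y ^ 2 / (2 * t) := by
    intro v
    rw [hst]
    field_simp
    ring
  have hker : ∀ v : ℝ, heatKernel (r⁻¹ - t⁻¹) (v / r) (y / t) * √(2 * Real.pi * (r⁻¹ - t⁻¹)) =
      Real.exp (-(y - v) ^ 2 / (2 * (t - r))) * Real.exp (-v ^ 2 / (2 * r) + y ^ 2 / (2 * t)) := by
    intro v
    rw [heatKernel, hexp, ← Real.exp_add, mul_right_comm, inv_mul_cancel₀ hsq, one_mul]
    ring_nf
  have h1 := hker (x + 2 * k * r)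
  have h2 := hker (-x - 2 * k * r)
  rw [show (x + 2 * k * r) / r = x / r + 2 * k by field_simp] at h1
  rw [show (-x - 2 * k * r) / r = -(x / r) - 2 * k by field_simp] at h2
  have e : ∀ v : ℝ, v ^ 2 = (x + 2 * k * r) ^ 2 →
      Real.exp (-v ^ 2 / (2 * r) + y ^ 2 / (2 * t)) * Real.exp (x ^ 2 / (2 * r) - y ^ 2 / (2 * t)) =
        Real.exp (-2 * (k * x + (k : ℝ) ^ 2 * r)) := by
    intro v hv
    rw [← Real.exp_add, hv]
    congr 1
    field_simp
    ring
  have e1 := e _ rfl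
  have e2 := e (-x - 2 * k * r) (by ring)
  rw [show (√(2 * Real.pi * (t - r)))⁻¹ * √(2 * Real.pi * (r⁻¹ - t⁻¹)) *
      Real.exp (x ^ 2 / (2 * r) - y ^ 2 / (2 * t)) *
        (heatKernel (r⁻¹ - t⁻¹) (x / r + 2 * k) (y / t) -
          heatKernel (r⁻¹ - t⁻¹) (-(x / r) - 2 * k) (y / t)) =
      (√(2 * Real.pi * (t - r)))⁻¹ * Real.exp (x ^ 2 / (2 * r) - y ^ 2 / (2 * t)) *
        (heatKernel (r⁻¹ - t⁻¹) (x / r + 2 * k) (y / t) * √(2 * Real.pi * (r⁻¹ - t⁻¹)) -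
          heatKernel (r⁻¹ - t⁻¹) (-(x / r) - 2 * k) (y / t) * √(2 * Real.pi * (r⁻¹ - t⁻¹)))
      by ring, h1, h2, heatKernel, heatKernel]
  linear_combination
    -(√(2 * Real.pi * (t - r)))⁻¹ * Real.exp (-(y - (x + 2 * k * r)) ^ 2 / (2 * (t - r))) * e1 +
    (√(2 * Real.pi * (t - r)))⁻¹ * Real.exp (-(y - (-x - 2 * k * r)) ^ 2 / (2 * (t - r))) * e2

/-- The Gaussian factors absorb the drift and the change of scale. -/
lemma gaussFactor_mul_killedConeDensity {r t : ℝ} (hr : 0 < r) (hrt : r < t) (μ x y : ℝ) :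
    gaussFactor μ r x * killedConeDensity μ r x t y =
      gaussFactor μ t y * (t⁻¹ * killedIntervalDensity (r⁻¹ - t⁻¹) (y / t) (x / r)) := by
  have ht : 0 < t := hr.trans hrt
  have htr : 0 < t - r := sub_pos.2 hrt
  have hs : 0 < r⁻¹ - t⁻¹ := sub_pos.2 (inv_strictAnti₀ hr hrt)
  have hpi := Real.pi_pos
  rw [killedConeDensity, killedConeDensityZero_eq hr hrt, killedIntervalDensity_comm hs (y / t),
    gaussFactor, gaussFactor]
  have hexp : Real.exp (-(x - μ * r) ^ 2 / (2 * r)) *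
      Real.exp (μ * (y - x) - (t - r) / 2 * μ ^ 2) * Real.exp (x ^ 2 / (2 * r) - y ^ 2 / (2 * t)) =
      Real.exp (-(y - μ * t) ^ 2 / (2 * t)) := by
    rw [← Real.exp_add, ← Real.exp_add]
    congr 1
    field_simp
    ring
  have hsqrt : (√(2 * Real.pi * r⁻¹))⁻¹ * ((√(2 * Real.pi * (t - r)))⁻¹ *
      √(2 * Real.pi * (r⁻¹ - t⁻¹))) = (√(2 * Real.pi * t⁻¹))⁻¹ * t⁻¹ := by
    have h2 : r⁻¹ - t⁻¹ = (t - r) * r⁻¹ * t⁻¹ := by field_simp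
    have hp : (0 : ℝ) ≤ 2 * Real.pi := by positivity
    rw [h2, mul_assoc (t - r), Real.sqrt_mul hp, Real.sqrt_mul hp, Real.sqrt_mul hp,
      Real.sqrt_mul hp, Real.sqrt_mul htr.le, Real.sqrt_mul (inv_pos.2 hr).le]
    have h3 : √t⁻¹ * √t⁻¹ = t⁻¹ := Real.mul_self_sqrt (by positivity)
    have h4 : √r⁻¹ ≠ 0 := by positivity
    have h5 : √t⁻¹ ≠ 0 := by positivity
    have h6 : √(t - r) ≠ 0 := by positivity
    generalize √t⁻¹ = a at *
    generalize √r⁻¹ = b at *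
    rw [← h3]
    field_simp
  rw [← hexp]
  linear_combination (2 * Real.exp (-(x - μ * r) ^ 2 / (2 * r)) *
      Real.exp (μ * (y - x) - (t - r) / 2 * μ ^ 2) *
      Real.exp (x ^ 2 / (2 * r) - y ^ 2 / (2 * t)) *
        killedIntervalDensity (r⁻¹ - t⁻¹) (x / r) (y / t)) * hsqrt

/-- The density at `y ∈ (0, t)` of `t Z_{1/t}`, where `Z` is the conditioned Brownian motion in
`[0, 1]` started from `μ`. -/
def invertedDensity (μ t y : ℝ) : ℝ := t⁻¹ * intervalDensity t⁻¹ μ (y / t)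

lemma div_mem_Ioo {t y : ℝ} (hy : y ∈ Ioo 0 t) : y / t ∈ Ioo (0 : ℝ) 1 := by
  have ht : 0 < t := hy.1.trans hy.2
  exact ⟨div_pos hy.1 ht, (div_lt_one ht).2 hy.2⟩

lemma invertedDensity_pos {μ t y : ℝ} (hμ : μ ∈ Icc (0 : ℝ) 1) (hy : y ∈ Ioo 0 t) :
    0 < invertedDensity μ t y := by
  have ht : 0 < t := hy.1.trans hy.2
  exact mul_pos (inv_pos.2 ht) (intervalDensity_pos (inv_pos.2 ht) hμ (div_mem_Ioo hy))

lemma measurable_invertedDensity {μ t : ℝ} (hμ : μ ∈ Icc (0 : ℝ) 1) (ht : 0 < t) :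
    Measurable (invertedDensity μ t) := by
  have := measurable_intervalDensity (inv_pos.2 ht) hμ
  unfold invertedDensity
  fun_prop

lemma measurable_coneDensity {r t : ℝ} (μ : ℝ) (hr : 0 < r) (hrt : r < t) :
    Measurable fun p : ℝ × ℝ => coneDensity μ r p.1 t p.2 := by
  have ht : 0 < t := hr.trans hrt
  have hs : 0 < r⁻¹ - t⁻¹ := sub_pos.2 (inv_strictAnti₀ hr hrt)
  have h1 := measurable_sinRatio (inv_pos.2 hr) μ
  have h2 := measurable_sinRatio (inv_pos.2 ht) μ
  have h3 := (continuous_killedIntervalDensity hs).measurable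
  unfold coneDensity killedConeDensity
  simp_rw [theta_eq hr, theta_eq ht, killedConeDensityZero_eq hr hrt, gaussFactor]
  fun_prop

/-- The entrance density is proportional to the density of `t Z_{1/t}`. -/
lemma coneEntranceDensity_eq {μ t : ℝ} (hμ : μ ∈ Icc (0 : ℝ) 1) (ht : 0 < t) (y : ℝ) :
    coneEntranceDensity μ t y = t * √(2 * Real.pi * t⁻¹) / 2 *
      Real.exp (-(Real.pi ^ 2 * t⁻¹ / 2)) * invertedDensity μ t y := by
  have hpi := Real.pi_pos
  have hsq : √(2 * Real.pi * t⁻¹) ≠ 0 := by positivity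
  rw [coneEntranceDensity, theta_eq ht, invertedDensity, intervalDensity_eq (inv_pos.2 ht) hμ,
    gaussFactor, Real.exp_neg, mul_comm _ Real.pi,
    show -(1 / (2 * t)) * (y - μ * t) ^ 2 = -(y - μ * t) ^ 2 / (2 * t) by ring]
  have h1 := Real.exp_ne_zero (-(y - μ * t) ^ 2 / (2 * t))
  have h2 := Real.exp_ne_zero (Real.pi ^ 2 * t⁻¹ / 2)
  generalize Real.exp (-(y - μ * t) ^ 2 / (2 * t)) = A at *
  generalize Real.exp (Real.pi ^ 2 * t⁻¹ / 2) = B at *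
  generalize √(2 * Real.pi * t⁻¹) = C at *
  field_simp

/-- Detailed balance: the transition densities of the conditioned Brownian motion in the cone are
those of the time reversal of `t ↦ t Z_{1/t}`. -/
lemma invertedDensity_mul_coneDensity {μ r t x y : ℝ} (hμ : μ ∈ Icc (0 : ℝ) 1) (hrt : r < t)
    (hx : x ∈ Ioo 0 r) (hy : y ∈ Ioo 0 t) :
    invertedDensity μ r x * coneDensity μ r x t y =
      invertedDensity μ t y * (r⁻¹ * doobIntervalDensity (r⁻¹ - t⁻¹) (y / t) (x / r)) := by
  have hr : 0 < r := hx.1.trans hx.2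
  have ht : 0 < t := hr.trans hrt
  have hψ := (sinRatio_pos (inv_pos.2 hr) hμ (div_mem_Ioo hx)).ne'
  have hsy := (sin_pi_mul_pos (div_mem_Ioo hy)).ne'
  have hgx := (gaussFactor_pos hr μ x).ne'
  have hgy := (gaussFactor_pos ht μ y).ne'
  have hB := gaussFactor_mul_killedConeDensity hr hrt μ x y
  have hexp : Real.exp (Real.pi ^ 2 * r⁻¹ / 2) = Real.exp (Real.pi ^ 2 * t⁻¹ / 2) *
      Real.exp (Real.pi ^ 2 * (r⁻¹ - t⁻¹) / 2) := by
    rw [← Real.exp_add]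
    ring_nf
  rw [invertedDensity, invertedDensity, intervalDensity_eq (inv_pos.2 hr) hμ,
    intervalDensity_eq (inv_pos.2 ht) hμ, coneDensity, theta_eq hr, theta_eq ht,
    doobIntervalDensity, hexp]
  have hk : killedConeDensity μ r x t y = gaussFactor μ t y *
      (t⁻¹ * killedIntervalDensity (r⁻¹ - t⁻¹) (y / t) (x / r)) / gaussFactor μ r x := by
    rw [eq_div_iff hgx, ← hB, mul_comm]
  rw [hk]
  generalize sinRatio r⁻¹ μ (x / r) = a at *
  generalize Real.sin (Real.pi * (y / t)) = b at *
  generalize killedIntervalDensity (r⁻¹ - t⁻¹) (y / t) (x / r) = c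
  generalize sinRatio t⁻¹ μ (y / t) = d
  generalize Real.sin (Real.pi * (x / r)) = e
  field_simp

/-! ### Markov processes in duality -/

/-- Conditional probabilities given by a kernel `K`, in integrated form and for nonnegative
functions. The family `K` need only agree with a measurable kernel `κ` almost everywhere along
`X`. -/
lemma lintegral_mul_comp_of_condExp {Ω : Type*} {m mΩ : MeasurableSpace Ω} {P : Measure Ω}
    [IsProbabilityMeasure P] (hm : m ≤ mΩ) {X Y : Ω → ℝ} (hX : Measurable X) (hY : Measurable Y)
    {K : ℝ → Measure ℝ} {κ : Kernel ℝ ℝ}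
    (h : ∀ S : Set ℝ, MeasurableSet S → P⟦Y ⁻¹' S | m⟧ =ᵐ[P] fun ω => (K (X ω)).real S)
    (hK : ∀ᵐ ω ∂P, K (X ω) = κ (X ω)) {H : Ω → ℝ≥0∞} (hH : Measurable[m] H)
    {g : ℝ → ℝ≥0∞} (hg : Measurable g) :
    ∫⁻ ω, H ω * g (Y ω) ∂P = ∫⁻ ω, H ω * ∫⁻ y, g y ∂κ (X ω) ∂P := by
  have hκX : Measurable fun ω => κ (X ω) := κ.measurable.comp hX
  -- Almost every conditional law has total mass one, so that `Measure.real` loses nothing.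
  have hfin : ∀ᵐ ω ∂P, IsFiniteMeasure (κ (X ω)) := by
    have h1 := h univ MeasurableSet.univ
    rw [preimage_univ, indicator_univ, condExp_const hm] at h1
    filter_upwards [h1, hK] with ω h1 h2
    refine ⟨lt_top_iff_ne_top.2 fun htop => ?_⟩
    rw [h2, measureReal_def, htop] at h1
    simp at h1
  have hset : ∀ A : Set Ω, MeasurableSet[m] A →
      (P.restrict A).map Y = (P.restrict A).bind fun ω => κ (X ω) := by
    intro A hA
    ext S hS
    rw [Measure.map_apply hY hS, Measure.bind_apply hS hκX.aemeasurable,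
      Measure.restrict_apply (hY hS)]
    have hYS : MeasurableSet (Y ⁻¹' S) := hY hS
    have h1 := setIntegral_condExp hm (f := (Y ⁻¹' S).indicator fun _ => (1 : ℝ)) (μ := P)
      ((integrable_const _).indicator hYS) hA
    rw [setIntegral_congr_ae (hm A hA) ((h S hS).mono fun ω hω _ => hω),
      setIntegral_indicator hYS] at h1
    have h2 : ∫⁻ ω in A, κ (X ω) S ∂P = ∫⁻ ω in A, ENNReal.ofReal ((K (X ω)).real S) ∂P := by
      refine lintegral_congr_ae (ae_restrict_of_ae ?_)
      filter_upwards [hfin, hK] with ω h3 h4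
      rw [h4, ofReal_measureReal]
    rw [h2, ← ofReal_integral_eq_lintegral_ofReal]
    · rw [h1, inter_comm]
      simp
    · exact ((integrable_condExp (m := m) (μ := P)).congr (h S hS)).integrableOn
    · exact Eventually.of_forall fun ω => measureReal_nonneg
  have hgκ : Measurable fun ω => ∫⁻ y, g y ∂κ (X ω) := hg.lintegral_kernel.comp hX
  have heq : (P.withDensity fun ω => g (Y ω)).trim hm =
      (P.withDensity fun ω => ∫⁻ y, g y ∂κ (X ω)).trim hm := by
    refine @Measure.ext _ m _ _ fun A hA => ?_
    rw [trim_measurableSet_eq hm hA, trim_measurableSet_eq hm hA, withDensity_apply _ (hm A hA),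
      withDensity_apply _ (hm A hA), ← lintegral_map hg hY, hset A hA,
      Measure.lintegral_bind hκX.aemeasurable hg.aemeasurable]
  have hH' : Measurable H := hH.mono hm le_rfl
  have := congrArg (fun ν => @lintegral Ω m ν H) heq
  simp only [lintegral_trim hm hH] at this
  rw [lintegral_withDensity_eq_lintegral_mul _ (f := fun ω => g (Y ω)) (hg.comp hY) hH',
    lintegral_withDensity_eq_lintegral_mul _ hgκ hH'] at this
  simpa only [Pi.mul_apply, mul_comm] using this

lemma measurable_prod_map {T Ω : Type*} {m : MeasurableSpace Ω} {X : T → Ω → ℝ≥0∞} {l : List T}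
    (h : ∀ t ∈ l, Measurable (X t)) : Measurable fun ω => (l.map fun t => X t ω).prod := by
  induction l with
  | nil => simp
  | cons t l ih =>
    simp only [List.map_cons, List.prod_cons]
    exact (h t List.mem_cons_self).mul (ih fun s hs => h s (List.mem_cons_of_mem _ hs))

/-- The probability of a cylinder set is the mean of a product over its sorted times. -/
lemma measure_pi_preimage_eq_lintegral {T Ω : Type*} [LinearOrder T] {mΩ : MeasurableSpace Ω}
    (P : Measure Ω) {X : T → Ω → ℝ} (hX : ∀ t, Measurable (X t)) (I : Finset T) {S : T → Set ℝ}
    (hS : ∀ t, MeasurableSet (S t)) :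
    P ((fun ω t => X t ω) ⁻¹' (I : Set T).pi S) =
      ∫⁻ ω, (I.sort.map fun t => (S t).indicator (1 : ℝ → ℝ≥0∞) (X t ω)).prod ∂P := by
  have hmeas : MeasurableSet ((fun ω t => X t ω) ⁻¹' (I : Set T).pi S) :=
    measurable_pi_lambda _ hX (MeasurableSet.pi I.countable_toSet fun t _ => hS t)
  rw [← lintegral_indicator_one hmeas]
  refine lintegral_congr fun ω => ?_
  rw [← List.prod_toFinset _ (I.sort_nodup _), Finset.sort_toFinset]
  by_cases h : ∀ t ∈ I, X t ω ∈ S t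
  · rw [indicator_of_mem (by simpa [Set.mem_pi] using h), Finset.prod_eq_one]
    · rfl
    · intro t ht
      rw [indicator_of_mem (h t ht)]
      rfl
  · rw [indicator_of_notMem (by simpa [Set.mem_pi] using h)]
    push Not at h
    obtain ⟨t, ht, hXt⟩ := h
    exact (Finset.prod_eq_zero ht (indicator_of_notMem hXt _)).symm

section Duality

variable {T Ω Ω' : Type*} [LinearOrder T] [mΩ : MeasurableSpace Ω] [mΩ' : MeasurableSpace Ω']
  {P : Measure Ω} {P' : Measure Ω'} {Y : T → Ω → ℝ} {W : T → Ω' → ℝ}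
  {F : T → MeasurableSpace Ω} {G : T → MeasurableSpace Ω'}
  {ν : T → Measure ℝ} [∀ t, SFinite (ν t)] {e : T → ℝ → ℝ≥0∞} {k k' : T → T → ℝ → ℝ → ℝ≥0∞}

/-- Two processes in duality: `Y` is Markov forward in time with kernels `k`, `W` is Markov backward
in time with kernels `k'`, they have the same one-dimensional densities `e`, and detailed balance
holds. Then for each product functional of times after `t` a single function `B` serves both as
the conditional expectation of that functional of `Y`, given the past of `Y` up to `t`, and as the
density, relative to the law of `W t`, of that functional of `W`. -/
lemma exists_duality
    (hYF : ∀ s t, s ≤ t → Measurable[F t] (Y s)) (hWG : ∀ s t, t ≤ s → Measurable[G t] (W s))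
    (hFmono : Monotone F)
    (he : ∀ t, Measurable (e t)) (hk : ∀ r t, r < t → Measurable (Function.uncurry (k r t)))
    (hk' : ∀ r t, r < t → Measurable (Function.uncurry (k' r t)))
    (hbal : ∀ r t, r < t → ∀ᵐ x ∂ν r, ∀ᵐ y ∂ν t, e r x * k r t x y = e t y * k' r t y x)
    (hmarkov : ∀ r t, r < t → ∀ H : Ω → ℝ≥0∞, Measurable[F r] H → ∀ g : ℝ → ℝ≥0∞, Measurable g →
      ∫⁻ ω, H ω * g (Y t ω) ∂P = ∫⁻ ω, H ω * ∫⁻ y, k r t (Y r ω) y * g y ∂ν t ∂P)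
    (hlaw' : ∀ t, ∀ g : ℝ → ℝ≥0∞, Measurable g →
      ∫⁻ ω, g (W t ω) ∂P' = ∫⁻ y, e t y * g y ∂ν t)
    (hmarkov' : ∀ r t, r < t → ∀ H : Ω' → ℝ≥0∞, Measurable[G t] H → ∀ g : ℝ → ℝ≥0∞,
      Measurable g →
      ∫⁻ ω, H ω * g (W r ω) ∂P' = ∫⁻ ω, H ω * ∫⁻ x, k' r t (W t ω) x * g x ∂ν r ∂P')
    {f : T → ℝ → ℝ≥0∞} (hf : ∀ t, Measurable (f t)) (l : List T) :
    ∀ t, (t :: l).Pairwise (· < ·) → ∃ B : ℝ → ℝ≥0∞, Measurable B ∧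
      (∀ H : Ω → ℝ≥0∞, Measurable[F t] H →
        ∫⁻ ω, H ω * (l.map fun s => f s (Y s ω)).prod ∂P = ∫⁻ ω, H ω * B (Y t ω) ∂P) ∧
      (∀ g : ℝ → ℝ≥0∞, Measurable g →
        ∫⁻ ω, (l.map fun s => f s (W s ω)).prod * g (W t ω) ∂P' =
          ∫⁻ y, e t y * (B y * g y) ∂ν t) := by
  induction l with
  | nil =>
    intro t _
    refine ⟨fun _ => 1, measurable_const, fun H hH => by simp, fun g hg => ?_⟩
    simpa using hlaw' t g hg
  | cons t l ih =>
    intro r hrl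
    rw [List.pairwise_cons] at hrl
    obtain ⟨hr, htl⟩ := hrl
    have hrt : r < t := hr t List.mem_cons_self
    obtain ⟨B, hB, hBY, hBW⟩ := ih t htl
    have hkm := hk r t hrt
    have hkm' := hk' r t hrt
    have hfB : Measurable fun y => f t y * B y := (hf t).mul hB
    refine ⟨fun x => ∫⁻ y, k r t x y * (f t y * B y) ∂ν t, ?_, fun H hH => ?_, fun g hg => ?_⟩
    · exact (hkm.mul (hfB.comp measurable_snd)).lintegral_prod_right'
    · have hft : Measurable[F t] fun ω => f t (Y t ω) := (hf t).comp (hYF t t le_rfl)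
      have hHt : Measurable[F t] fun ω => H ω * f t (Y t ω) :=
        Measurable.fun_mul (hH.mono (hFmono hrt.le) le_rfl) hft
      simp only [List.map_cons, List.prod_cons, ← mul_assoc]
      rw [hBY _ hHt]
      simp only [mul_assoc]
      exact hmarkov r t hrt H hH _ hfB
    · have hprod : Measurable[G t] fun ω => ((t :: l).map fun s => f s (W s ω)).prod := by
        refine measurable_prod_map fun s hs => (hf s).comp (hWG s t ?_)
        rcases List.mem_cons.1 hs with rfl | hs
        exacts [le_rfl, ((List.pairwise_cons.1 htl).1 s hs).le]
      rw [hmarkov' r t hrt _ hprod g hg]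
      have hgk : Measurable fun y => ∫⁻ x, k' r t y x * g x ∂ν r :=
        (hkm'.mul (hg.comp measurable_snd)).lintegral_prod_right'
      have h1 := hBW (fun y => f t y * ∫⁻ x, k' r t y x * g x ∂ν r) ((hf t).mul hgk)
      simp only [List.map_cons, List.prod_cons]
      calc _ = ∫⁻ y, e t y * (B y * (f t y * ∫⁻ x, k' r t y x * g x ∂ν r)) ∂ν t := by
            rw [← h1]
            refine lintegral_congr fun ω => ?_
            ring
        _ = ∫⁻ y, ∫⁻ x, e t y * k' r t y x * (f t y * B y) * g x ∂ν r ∂ν t := by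
            refine lintegral_congr fun y => ?_
            rw [← mul_assoc, ← mul_assoc, ← lintegral_const_mul]
            · refine lintegral_congr fun x => ?_
              ring
            · exact (hkm'.comp measurable_prodMk_left).mul hg
        _ = ∫⁻ x, ∫⁻ y, e t y * k' r t y x * (f t y * B y) * g x ∂ν t ∂ν r := by
            refine lintegral_lintegral_swap (Measurable.aemeasurable ?_)
            exact ((((he t).comp measurable_fst).mul hkm').mul (hfB.comp measurable_fst)).mul
              (hg.comp measurable_snd)
        _ = ∫⁻ x, e r x * ((∫⁻ y, k r t x y * (f t y * B y) ∂ν t) * g x) ∂ν r := by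
            refine lintegral_congr_ae ((hbal r t hrt).mono fun x hx => ?_)
            have hkx : Measurable fun y => k r t x y * (f t y * B y) :=
              (hkm.comp measurable_prodMk_left).mul hfB
            simp only
            rw [mul_comm _ (g x), ← mul_assoc, ← lintegral_const_mul _ hkx]
            refine lintegral_congr_ae (hx.mono fun y hy => ?_)
            simp only
            rw [← hy]
            ring

/-- Processes in duality have the same law. -/
theorem map_eq_map_of_duality [IsProbabilityMeasure P] [IsProbabilityMeasure P']
    (hYF : ∀ s t, s ≤ t → Measurable[F t] (Y s)) (hWG : ∀ s t, t ≤ s → Measurable[G t] (W s))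
    (hFmono : Monotone F) (hF : ∀ t, F t ≤ mΩ) (hG : ∀ t, G t ≤ mΩ')
    (he : ∀ t, Measurable (e t)) (hk : ∀ r t, r < t → Measurable (Function.uncurry (k r t)))
    (hk' : ∀ r t, r < t → Measurable (Function.uncurry (k' r t)))
    (hbal : ∀ r t, r < t → ∀ᵐ x ∂ν r, ∀ᵐ y ∂ν t, e r x * k r t x y = e t y * k' r t y x)
    (hlaw : ∀ t, ∀ g : ℝ → ℝ≥0∞, Measurable g →
      ∫⁻ ω, g (Y t ω) ∂P = ∫⁻ y, e t y * g y ∂ν t)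
    (hmarkov : ∀ r t, r < t → ∀ H : Ω → ℝ≥0∞, Measurable[F r] H → ∀ g : ℝ → ℝ≥0∞, Measurable g →
      ∫⁻ ω, H ω * g (Y t ω) ∂P = ∫⁻ ω, H ω * ∫⁻ y, k r t (Y r ω) y * g y ∂ν t ∂P)
    (hlaw' : ∀ t, ∀ g : ℝ → ℝ≥0∞, Measurable g →
      ∫⁻ ω, g (W t ω) ∂P' = ∫⁻ y, e t y * g y ∂ν t)
    (hmarkov' : ∀ r t, r < t → ∀ H : Ω' → ℝ≥0∞, Measurable[G t] H → ∀ g : ℝ → ℝ≥0∞,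
      Measurable g →
      ∫⁻ ω, H ω * g (W r ω) ∂P' = ∫⁻ ω, H ω * ∫⁻ x, k' r t (W t ω) x * g x ∂ν r ∂P') :
    P.map (fun ω t => Y t ω) = P'.map fun ω t => W t ω := by
  have hY : ∀ t, Measurable (Y t) := fun t => (hYF t t le_rfl).mono (hF t) le_rfl
  have hW : ∀ t, Measurable (W t) := fun t => (hWG t t le_rfl).mono (hG t) le_rfl
  have hYm : Measurable fun ω t => Y t ω := measurable_pi_lambda _ hY
  have hWm : Measurable fun ω t => W t ω := measurable_pi_lambda _ hW
  have := Measure.isProbabilityMeasure_map hYm.aemeasurable (μ := P)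
  have := Measure.isProbabilityMeasure_map hWm.aemeasurable (μ := P')
  refine ext_of_generate_finite _ (generateFrom_squareCylinders (α := fun _ : T => ℝ)).symm
    (isPiSystem_squareCylinders (fun _ => MeasurableSpace.isPiSystem_measurableSet)
      fun _ => MeasurableSet.univ (α := ℝ)) ?_ (by simp)
  rintro _ ⟨I, S, hS, rfl⟩
  have hS' : ∀ t, MeasurableSet (S t) := fun t => hS t (mem_univ t)
  have hbox : MeasurableSet ((I : Set T).pi S) :=
    MeasurableSet.pi I.countable_toSet fun t _ => hS' t
  rw [Measure.map_apply hYm hbox, Measure.map_apply hWm hbox]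
  -- Everything reduces to products of indicators along increasing finite sequences of times.
  let f : T → ℝ → ℝ≥0∞ := fun t => (S t).indicator 1
  have hf : ∀ t, Measurable (f t) := fun t => measurable_one.indicator (hS' t)
  rw [measure_pi_preimage_eq_lintegral P hY I hS', measure_pi_preimage_eq_lintegral P' hW I hS']
  have hsort : I.sort.Pairwise (· < ·) := I.sortedLT_sort.pairwise
  generalize I.sort = L at hsort ⊢
  rcases L with _ | ⟨t, l⟩
  · simp
  obtain ⟨B, hB, hBY, hBW⟩ := exists_duality hYF hWG hFmono he hk hk' hbal hmarkov hlaw' hmarkov'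
    hf l t hsort
  calc _ = ∫⁻ ω, f t (Y t ω) * (l.map fun s => f s (Y s ω)).prod ∂P := rfl
    _ = ∫⁻ ω, f t (Y t ω) * B (Y t ω) ∂P := hBY _ ((hf t).comp (hYF t t le_rfl))
    _ = ∫⁻ y, e t y * (f t y * B y) ∂ν t := hlaw t _ ((hf t).mul hB)
    _ = ∫⁻ y, e t y * (B y * f t y) ∂ν t := by simp_rw [mul_comm (B _)]
    _ = ∫⁻ ω, (l.map fun s => f s (W s ω)).prod * f t (W t ω) ∂P' := (hBW _ (hf t)).symm
    _ = _ := by simp_rw [mul_comm _ (f t _)]; rfl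

end Duality

/-! ### The Markov properties in integrated form -/

lemma history_mono {Ω E : Type*} [MeasurableSpace E] (X : ℝ≥0 → Ω → E) : Monotone (history X) :=
  fun _ _ hrt => biSup_mono fun _ hs => le_trans hs hrt

lemma history_le {Ω E : Type*} [mΩ : MeasurableSpace Ω] [MeasurableSpace E] {X : ℝ≥0 → Ω → E}
    (hX : ∀ t, Measurable (X t)) (r : ℝ≥0) : history X r ≤ mΩ :=
  iSup₂_le fun s _ => (hX s).comap_le

lemma measurable_history {Ω E : Type*} [MeasurableSpace E] (X : ℝ≥0 → Ω → E) {s r : ℝ≥0}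
    (hsr : s ≤ r) : Measurable[history X r] (X s) :=
  Measurable.mono (comap_measurable (X s))
    (le_iSup₂ (f := fun s (_ : s ∈ Iic r) => MeasurableSpace.comap (X s) inferInstance) s hsr)
    le_rfl

lemma setLIntegral_Ioo_div {r : ℝ} (hr : 0 < r) (h : ℝ → ℝ≥0∞) :
    ∫⁻ z in Ioo (0 : ℝ) 1, h z = ∫⁻ x in Ioo 0 r, ENNReal.ofReal r⁻¹ * h (x / r) := by
  have himg : (fun x => x / r) '' Ioo 0 r = Ioo (0 : ℝ) 1 := by
    ext z
    constructor
    · rintro ⟨x, hx, rfl⟩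
      exact div_mem_Ioo hx
    · rintro ⟨h0, h1⟩
      exact ⟨z * r, ⟨mul_pos h0 hr, by nlinarith⟩, mul_div_cancel_right₀ _ hr.ne'⟩
  rw [← himg, lintegral_image_eq_lintegral_abs_deriv_mul measurableSet_Ioo
    (f' := fun _ => r⁻¹) (fun x _ => ?_) (fun x _ y _ hxy => (div_left_inj' hr.ne').1 hxy)]
  · rw [abs_of_pos (inv_pos.2 hr)]
  · simpa using ((hasDerivAt_id x).div_const r).hasDerivWithinAt

section Interval

variable {Ω : Type*} [MeasurableSpace Ω] {P : Measure Ω} [IsProbabilityMeasure P] {μ : ℝ}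
  {Z : ℝ≥0 → Ω → ℝ}

/-- The law of `Z s` is read off from the Markov property at time `0`. -/
lemma IsConditionedIntervalBM.lintegral_comp (hZ : IsConditionedIntervalBM μ Z P)
    (hμ : μ ∈ Icc (0 : ℝ) 1) {s : ℝ≥0} (hs : 0 < s) {g : ℝ → ℝ≥0∞} (hg : Measurable g) :
    ∫⁻ ω, g (Z s ω) ∂P =
      ∫⁻ z in Ioo (0 : ℝ) 1, ENNReal.ofReal (intervalDensity s μ z) * g z := by
  have h := lintegral_mul_comp_of_condExp (history_le hZ.measurable 0) (hZ.measurable 0)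
    (hZ.measurable s) (κ := Kernel.const ℝ (intervalTransition s μ)) (hZ.markov 0 s hs)
    (hZ.start.mono fun ω hω => by simp [hω]) (H := fun _ => 1) measurable_const hg
  simp only [one_mul, Kernel.const_apply, lintegral_const, measure_univ, mul_one] at h
  rw [h, intervalTransition, lintegral_withDensity_eq_lintegral_mul _
    (measurable_intervalDensity (NNReal.coe_pos.2 hs) hμ).ennreal_ofReal hg]
  rfl

lemma IsConditionedIntervalBM.ae_mem_Ioo (hZ : IsConditionedIntervalBM μ Z P)
    (hμ : μ ∈ Icc (0 : ℝ) 1) {s : ℝ≥0} (hs : 0 < s) : ∀ᵐ ω ∂P, Z s ω ∈ Ioo (0 : ℝ) 1 := by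
  have h := hZ.lintegral_comp hμ hs
    (measurable_one.indicator (measurableSet_Ioo (a := (0 : ℝ)) (b := 1)).compl)
  rw [setLIntegral_congr_fun (g := fun _ => 0) measurableSet_Ioo fun z hz => by simp [hz],
    lintegral_zero] at h
  have hm : MeasurableSet (Z s ⁻¹' (Ioo (0 : ℝ) 1)ᶜ) :=
    hZ.measurable s measurableSet_Ioo.compl
  rw [ae_iff, ← h]
  exact (lintegral_indicator_one hm).symm

lemma IsConditionedIntervalBM.lintegral_inverted (hZ : IsConditionedIntervalBM μ Z P)
    (hμ : μ ∈ Icc (0 : ℝ) 1) {t : ℝ≥0} (ht : 0 < t) {g : ℝ → ℝ≥0∞} (hg : Measurable g) :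
    ∫⁻ ω, g (t * Z t⁻¹ ω) ∂P =
      ∫⁻ y in Ioo (0 : ℝ) t, ENNReal.ofReal (invertedDensity μ t y) * g y := by
  have ht' : (0 : ℝ) < t := NNReal.coe_pos.2 ht
  rw [hZ.lintegral_comp hμ (inv_pos.2 ht) (g := fun z => g (t * z)) (by fun_prop),
    setLIntegral_Ioo_div ht']
  refine lintegral_congr fun y => ?_
  rw [invertedDensity, ENNReal.ofReal_mul (inv_pos.2 ht').le, NNReal.coe_inv, ← mul_assoc,
    mul_div_cancel₀ _ ht'.ne']

/-- The Markov property of `t ↦ t Z_{1/t}`, run backwards in time. -/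
lemma IsConditionedIntervalBM.lintegral_mul_inverted (hZ : IsConditionedIntervalBM μ Z P)
    (hμ : μ ∈ Icc (0 : ℝ) 1) {r t : ℝ≥0} (hr : 0 < r) (hrt : r < t) {H : Ω → ℝ≥0∞}
    (hH : Measurable[history Z t⁻¹] H) {g : ℝ → ℝ≥0∞} (hg : Measurable g) :
    ∫⁻ ω, H ω * g (r * Z r⁻¹ ω) ∂P = ∫⁻ ω, H ω * (∫⁻ x in Ioo (0 : ℝ) r,
      ENNReal.ofReal ((r : ℝ)⁻¹ * doobIntervalDensity ((r : ℝ)⁻¹ - (t : ℝ)⁻¹)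
        (t * Z t⁻¹ ω / t) (x / r)) * g x) ∂P := by
  have ht : 0 < t := hr.trans hrt
  have hr' : (0 : ℝ) < r := NNReal.coe_pos.2 hr
  have ht' : (0 : ℝ) < t := NNReal.coe_pos.2 ht
  have hs : (0 : ℝ) < (r : ℝ)⁻¹ - (t : ℝ)⁻¹ := sub_pos.2 (inv_strictAnti₀ hr' hrt)
  set s : ℝ := (r : ℝ)⁻¹ - (t : ℝ)⁻¹ with hs_def
  have hd : Measurable (Function.uncurry fun x z => ENNReal.ofReal (doobIntervalDensity s x z)) :=
    (measurable_doobIntervalDensity hs).ennreal_ofReal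
  rw [lintegral_mul_comp_of_condExp (history_le hZ.measurable t⁻¹) (hZ.measurable t⁻¹)
    (hZ.measurable r⁻¹) (κ := Kernel.withDensity
      (Kernel.const ℝ (volume.restrict (Ioo (0 : ℝ) 1)))
      fun x z => ENNReal.ofReal (doobIntervalDensity s x z))
    (hZ.markov t⁻¹ r⁻¹ (inv_strictAnti₀ hr hrt)) ?_ hH (g := fun z => g (r * z)) (by fun_prop)]
  · refine lintegral_congr fun ω => ?_
    congr 1
    rw [Kernel.lintegral_withDensity _ hd _ (by fun_prop), Kernel.const_apply,
      setLIntegral_Ioo_div hr']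
    refine lintegral_congr fun x => ?_
    rw [ENNReal.ofReal_mul (inv_pos.2 hr').le, mul_div_cancel_left₀ _ ht'.ne', ← mul_assoc,
      mul_div_cancel₀ _ hr'.ne']
  · filter_upwards [hZ.ae_mem_Ioo hμ (inv_pos.2 ht)] with ω hω
    rw [Kernel.withDensity_apply _ hd, Kernel.const_apply, intervalTransition]
    simp only [intervalDensity_of_mem hω, NNReal.coe_inv, hs_def]

end Interval

section Cone

variable {Ω : Type*} [MeasurableSpace Ω] {P : Measure Ω} {μ : ℝ}
  {A : ℝ≥0 → Ω → ℝ × ℝ}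

/-- The Markov property in the cone, in integrated form. -/
lemma IsConditionedConeBM.lintegral_mul_comp [IsProbabilityMeasure P]
    (hA : IsConditionedConeBM μ A P)
    {r t : ℝ≥0} (hr : 0 < r) (hrt : r < t) {H : Ω → ℝ≥0∞}
    (hH : Measurable[history A r] H) {g : ℝ → ℝ≥0∞} (hg : Measurable g) :
    ∫⁻ ω, H ω * g (A t ω).2 ∂P = ∫⁻ ω, H ω * (∫⁻ y in Ioo (0 : ℝ) t,
      ENNReal.ofReal (coneDensity μ r (A r ω).2 t y) * g y) ∂P := by
  have hd : Measurable (Function.uncurry fun x y => ENNReal.ofReal (coneDensity μ r x t y)) :=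
    (measurable_coneDensity μ (NNReal.coe_pos.2 hr) (NNReal.coe_lt_coe.2 hrt)).ennreal_ofReal
  rw [lintegral_mul_comp_of_condExp (history_le hA.measurable r) (hA.measurable r).snd
    (hA.measurable t).snd (K := fun x => coneTransition μ r x t) (κ := Kernel.withDensity
      (Kernel.const ℝ (volume.restrict (Ioo (0 : ℝ) t)))
      fun x y => ENNReal.ofReal (coneDensity μ r x t y)) (hA.markov r t hr hrt)
    (Eventually.of_forall fun ω => ?_) hH hg]
  · refine lintegral_congr fun ω => ?_
    rw [Kernel.lintegral_withDensity _ hd _ hg, Kernel.const_apply]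
  · rw [Kernel.withDensity_apply _ hd, Kernel.const_apply, coneTransition]

/-- The normalizing constant of the entrance law is determined by any probability density
proportional to it. -/
lemma IsConditionedConeBM.lintegral_comp (hA : IsConditionedConeBM μ A P)
    (hμ : μ ∈ Icc (0 : ℝ) 1) {t : ℝ≥0} (ht : 0 < t)
    (hone : ∫⁻ y in Ioo (0 : ℝ) t, ENNReal.ofReal (invertedDensity μ t y) = 1)
    {g : ℝ → ℝ≥0∞} (hg : Measurable g) :
    ∫⁻ ω, g (A t ω).2 ∂P =
      ∫⁻ y in Ioo (0 : ℝ) t, ENNReal.ofReal (invertedDensity μ t y) * g y := by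
  have ht' : (0 : ℝ) < t := NNReal.coe_pos.2 ht
  have hpi := Real.pi_pos
  have hm := (measurable_invertedDensity hμ ht').ennreal_ofReal
  obtain ⟨c, hc, hdens⟩ : ∃ c : ℝ, 0 < c ∧
      ∀ y, coneEntranceDensity μ t y = c * invertedDensity μ t y :=
    ⟨_, by positivity, coneEntranceDensity_eq hμ ht'⟩
  have hE : coneEntrance μ t = ENNReal.ofReal c • (volume.restrict (Ioo (0 : ℝ) t)).withDensity
      fun y => ENNReal.ofReal (invertedDensity μ t y) := by
    rw [coneEntrance, ← withDensity_smul _ hm]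
    simp only [hdens, ENNReal.ofReal_mul hc.le]
    rfl
  have hlaw := hA.entrance t ht
  rw [hE, Measure.smul_apply, withDensity_apply _ MeasurableSet.univ, Measure.restrict_univ, hone,
    smul_smul, smul_eq_mul, mul_one, ENNReal.inv_mul_cancel (ENNReal.ofReal_pos.2 hc).ne'
    ENNReal.ofReal_ne_top, one_smul] at hlaw
  rw [← lintegral_map hg (hA.measurable t).snd, hlaw,
    lintegral_withDensity_eq_lintegral_mul _ hm hg]
  rfl

end Cone

end CondBM

end

theorem theorem5p7 (μ : ℝ) (hμ : μ ∈ Set.Icc (0 : ℝ) 1)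
    {Ω Ω' : Type*} [MeasurableSpace Ω] [MeasurableSpace Ω']
    (P : MeasureTheory.Measure Ω) [MeasureTheory.IsProbabilityMeasure P]
    (P' : MeasureTheory.Measure Ω') [MeasureTheory.IsProbabilityMeasure P']
    (A : NNReal → Ω → ℝ × ℝ) (hA : CondBM.IsConditionedConeBM μ A P)
    (Z : NNReal → Ω' → ℝ) (hZ : CondBM.IsConditionedIntervalBM μ Z P') :
    ProbabilityTheory.IdentDistrib
      (fun ω (t : Set.Ioi (0 : NNReal)) => A t ω)
      (fun ω (t : Set.Ioi (0 : NNReal)) =>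
        (((t : NNReal) : ℝ), ((t : NNReal) : ℝ) * Z (t : NNReal)⁻¹ ω))
      P P' := by
  have hAm := hA.measurable
  have hZm := hZ.measurable
  have hpos : ∀ t : Ioi (0 : ℝ≥0), (0 : ℝ) < (t : ℝ≥0) := fun t => NNReal.coe_pos.2 t.2
  have hone : ∀ t : Ioi (0 : ℝ≥0), ∫⁻ y in Ioo (0 : ℝ) (t : ℝ≥0),
      ENNReal.ofReal (CondBM.invertedDensity μ (t : ℝ≥0) y) = 1 := by
    intro t
    simpa using (hZ.lintegral_inverted hμ t.2 (g := fun _ => 1) measurable_const).symm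
  -- The time coordinate is deterministic, so it suffices to compare the space coordinates.
  have hspace : P.map (fun ω (t : Ioi (0 : ℝ≥0)) => (A t ω).2) =
      P'.map fun ω (t : Ioi (0 : ℝ≥0)) => ((t : ℝ≥0) : ℝ) * Z (t : ℝ≥0)⁻¹ ω := by
    refine CondBM.map_eq_map_of_duality
      (Y := fun (t : Ioi (0 : ℝ≥0)) ω => (A t ω).2)
      (W := fun (t : Ioi (0 : ℝ≥0)) ω => ((t : ℝ≥0) : ℝ) * Z (t : ℝ≥0)⁻¹ ω)
      (F := fun t => CondBM.history A t) (G := fun t => CondBM.history Z (t : ℝ≥0)⁻¹)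
      (ν := fun t => volume.restrict (Ioo (0 : ℝ) (t : ℝ≥0)))
      (e := fun t y => ENNReal.ofReal (CondBM.invertedDensity μ (t : ℝ≥0) y))
      (k := fun r t x y => ENNReal.ofReal (CondBM.coneDensity μ (r : ℝ≥0) x (t : ℝ≥0) y))
      (k' := fun r t y x => ENNReal.ofReal (((r : ℝ≥0) : ℝ)⁻¹ * CondBM.doobIntervalDensity
        (((r : ℝ≥0) : ℝ)⁻¹ - ((t : ℝ≥0) : ℝ)⁻¹) (y / (t : ℝ≥0)) (x / (r : ℝ≥0))))
      ?_ ?_ ?_ ?_ ?_ ?_ ?_ ?_ ?_ ?_ ?_ ?_ ?_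
    · exact fun s t hst => (CondBM.measurable_history A hst).snd
    · exact fun s t hts =>
        (CondBM.measurable_history Z (inv_anti₀ t.2 hts)).const_mul _
    · exact fun s t hst => CondBM.history_mono A hst
    · exact fun t => CondBM.history_le hAm t
    · exact fun t => CondBM.history_le hZm _
    · exact fun t => (CondBM.measurable_invertedDensity hμ (hpos t)).ennreal_ofReal
    · exact fun r t hrt => (CondBM.measurable_coneDensity μ (hpos r)
        (NNReal.coe_lt_coe.2 hrt)).ennreal_ofReal
    · intro r t hrt
      have hs := CondBM.measurable_doobIntervalDensity
        (sub_pos.2 (inv_strictAnti₀ (hpos r) (NNReal.coe_lt_coe.2 hrt)))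
      have h2 : Measurable fun p : ℝ × ℝ => (p.1 / ((t : ℝ≥0) : ℝ), p.2 / ((r : ℝ≥0) : ℝ)) := by
        fun_prop
      exact ((hs.comp h2).const_mul _).ennreal_ofReal
    · intro r t hrt
      filter_upwards [ae_restrict_mem measurableSet_Ioo] with x hx
      filter_upwards [ae_restrict_mem measurableSet_Ioo] with y hy
      rw [← ENNReal.ofReal_mul (CondBM.invertedDensity_pos hμ hx).le,
        ← ENNReal.ofReal_mul (CondBM.invertedDensity_pos hμ hy).le,
        CondBM.invertedDensity_mul_coneDensity hμ (NNReal.coe_lt_coe.2 hrt) hx hy]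
    · exact fun t g hg => hA.lintegral_comp hμ t.2 (hone t) hg
    · exact fun r t hrt H hH g hg => hA.lintegral_mul_comp r.2 hrt hH hg
    · exact fun t g hg => hZ.lintegral_inverted hμ t.2 hg
    · exact fun r t hrt H hH g hg => hZ.lintegral_mul_inverted hμ r.2 hrt hH hg
  have hΨ : Measurable fun (y : Ioi (0 : ℝ≥0) → ℝ) (t : Ioi (0 : ℝ≥0)) =>
      (((t : ℝ≥0) : ℝ), y t) := by fun_prop
  have hYm : Measurable fun ω (t : Ioi (0 : ℝ≥0)) => (A t ω).2 := by fun_prop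
  have hWm : Measurable fun ω (t : Ioi (0 : ℝ≥0)) =>
    ((t : ℝ≥0) : ℝ) * Z (t : ℝ≥0)⁻¹ ω := by fun_prop
  refine ⟨Measurable.aemeasurable (by fun_prop), Measurable.aemeasurable (by fun_prop), ?_⟩
  rw [map_eq_of_forall_ae_eq (Y := fun (t : Ioi (0 : ℝ≥0)) ω => (((t : ℝ≥0) : ℝ), (A t ω).2))
    (Measurable.aemeasurable (by fun_prop)) (Measurable.aemeasurable (by fun_prop))
    fun t => (hA.time t).mono fun ω hω => Prod.ext hω rfl]
  have h := congrArg (Measure.map fun (y : Ioi (0 : ℝ≥0) → ℝ) (t : Ioi (0 : ℝ≥0)) =>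
    (((t : ℝ≥0) : ℝ), y t)) hspace
  rwa [Measure.map_map hΨ hYm, Measure.map_map hΨ hWm] at h
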